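/- **Setting.** For $n\ge 1$ let $k=k_n\in\mathbb N$, $\theta=\theta_n\in[0,\infty)^n$, and real $p=p_n$, $q=q_n$, $\delta=\delta_n$ with $0<q<p$; let $\alpha,\beta\ge 1$ be constants. The parameter space $\mathcal P_n'(\theta,p,q,k,\beta;\delta,\alpha)$ consists of the matrices $P=(\theta_i\theta_jB_{z(i)z(j)}\mathbf 1\{i\ne j\})\in[0,1]^{n\times n}$ with $z\in[k]^n$ and a symmetric $B\in\mathbb R^{k\times k}$ such that, with $n_u=|\{i:z(i)=u\}|$, $$\frac1{n_u}\sum_{i:z(i)=u}\theta_i\in[1-\delta,1+\delta],\qquad \frac{n}{\beta k}-1\le n_u\le\frac{\beta n}{k}+1\quad(u\in[k]),\qquad \max_{u\ne v}B_{uv}\le q<p\le\min_uB_{uu},\qquad \max_uB_{uu}\le\alpha p .$$ One observes a symmetric $A\in\{0,1\}^{n\times n}$ with zero diagonal whose entries $A_{ij}$, $i<j$, are independent with $A_{ij}\sim\mathrm{Bernoulli}(P_{ij})$. **Weighted $k$-medians clustering** (input $A$, $k$, $\tau$, slack $\epsilon\ge0$). (1) $T_\tau(A)$ is $A$ with the $i$th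 row and column replaced by zeroes for each $i$ whose row sum in $A$ exceeds $\tau$. (2) $\hat P$ is any minimizer of $\|T_\tau(A)-Q\|_F^2$ over $Q\in\mathbb R^{n\times n}$ with $\mathrm{rank}(Q)\le k$. (3) With $\hat P_i$ the $i$th row of $\hat P$ and $S_0=\{i:\|\hat P_i\|_1=0\}$, set $\hat z(i)=0$ for $i\in S_0$ and $\tilde P_i=\hat P_i/\|\hat P_i\|_1$ for $i\notin S_0$. (4) $\{\hat z(i)\}_{i\notin S_0}$ are any labels in $[k]$ with $$\sum_{u=1}^k\min_{v\in\mathbb R^n}\sum_{i\notin S_0,\,\hat z(i)=u}\|\hat P_i\|_1\|\tilde P_i-v\|_1\le(1+\epsilon)\min_{z'\in[k]^n}\sum_{u=1}^k\min_{v\in\mathbb R^n}\sum_{i\notin S_0,\,z'(i)=u}\|\hat P_i\|_1\|\tilde P_i-v\|_1 .$$ **Lemma.** For all constants $\alpha,\beta\ge1$ there is $C_0>0$ such that for every constant $C_1\ge C_0$ there are constants $C',C>0$ with the following property. Assume that, as $n\to\infty$, $\delta=o(1)$, $1<p/q=O(1)$ and $\|\theta\|_\infty=o(n/k)$, and let $\tau=C_1(np\|\theta\|_\infty^2+1)$.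 Then for all sufficiently large $n$, for every model in $\mathcal P_n'(\theta,p,q,k,\beta;\delta,\alpha)$ with label vector $z$ and for every $\epsilon\ge0$, with probability at least $1-n^{-(1+C')}$ every output $\hat z$ of weighted $k$-medians clustering applied to $A$ with this $\tau$ satisfies $$\min_{\pi}\sum_{i:\hat z(i)\ne\pi(z(i))}\theta_i\le C\,\frac{(1+\epsilon)\,k^{5/2}\sqrt{n\|\theta\|_\infty^2p+1}}{p-q},$$ where $\pi$ runs over the permutations of $[k]$. No eigen-gap condition is imposed. -/

import Mathlib

open Filter Topology Asymptotics MeasureTheory ProbabilityTheory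

namespace DCBM

noncomputable section

open scoped Classical in
/-- The size `n_u(z)` of the `u`-th community of the labelling `z`. -/
def commSize {n k : ℕ} (z : Fin n → Fin k) (u : Fin k) : ℕ :=
  (Finset.univ.filter fun i => z i = u).card

/-- The edge probability matrix `P_{ij} = θ_i θ_j B_{z(i) z(j)}` for `i ≠ j`, with zero diagonal. -/
def probMatrix {n k : ℕ} (θ : Fin n → ℝ) (z : Fin n → Fin k) (B : Matrix (Fin k) (Fin k) ℝ) :
    Matrix (Fin n) (Fin n) ℝ :=
  Matrix.of fun i j => if i = j then 0 else θ i * θ j * B (z i) (z j)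

open scoped Classical in
/-- `(z, B)` generates an element of the parameter space `P_n(θ, p, q, k, β; δ)`. -/
structure MemSpace {n k : ℕ} (θ : Fin n → ℝ) (p q β δ : ℝ)
    (z : Fin n → Fin k) (B : Matrix (Fin k) (Fin k) ℝ) : Prop where
  symm : B.IsSymm
  prob_mem : ∀ i j, probMatrix θ z B i j ∈ Set.Icc (0 : ℝ) 1
  normalized : ∀ u, (1 / (commSize z u : ℝ)) * ∑ i with z i = u, θ i ∈ Set.Icc (1 - δ) (1 + δ)
  between_le : ∀ u v, u ≠ v → B u v ≤ q
  lt : q < p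
  le_within : ∀ u, p ≤ B u u
  le_size : ∀ u, (n : ℝ) / (β * k) - 1 ≤ commSize z u
  size_le : ∀ u, (commSize z u : ℝ) ≤ β * n / k + 1

/-- `(z, B)` generates an element of the parameter space `P_n'(θ, p, q, k, β; δ, α)`, in which
also `max_u B_{uu} ≤ α p`. -/
structure MemSpace' {n k : ℕ} (θ : Fin n → ℝ) (p q β δ α : ℝ)
    (z : Fin n → Fin k) (B : Matrix (Fin k) (Fin k) ℝ) : Prop
    extends MemSpace θ p q β δ z B where
  within_le : ∀ u, B u u ≤ α * p

/-- `A` is the random adjacency matrix of a simple undirected graph on `n` nodes whose edges are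
independent, the edge `{i, j}` being present with probability `P i j`. -/
structure IsRandomGraph {n : ℕ} {Ω : Type*} [MeasurableSpace Ω] (μ : Measure Ω)
    (P : Matrix (Fin n) (Fin n) ℝ) (A : Ω → Matrix (Fin n) (Fin n) ℝ) : Prop where
  diag : ∀ ω i, A ω i i = 0
  symm : ∀ ω i j, A ω i j = A ω j i
  zero_or_one : ∀ ω i j, A ω i j = 0 ∨ A ω i j = 1
  measurable : ∀ i j, Measurable fun ω => A ω i j
  prob : ∀ i j, i ≠ j → μ {ω | A ω i j = 1} = ENNReal.ofReal (P i j)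
  indep : iIndepFun (fun (e : {e : Fin n × Fin n // e.1 < e.2}) ω => A ω e.1.1 e.1.2) μ

open scoped Classical in
/-- Step 1: `T_τ(A)` is `A` with the `i`-th row and column replaced by zeroes for every `i` whose
row sum in `A` is larger than `τ`. -/
def trim {n : ℕ} (τ : ℝ) (A : Matrix (Fin n) (Fin n) ℝ) : Matrix (Fin n) (Fin n) ℝ :=
  Matrix.of fun i j => if τ < ∑ l, A i l ∨ τ < ∑ l, A j l then 0 else A i j

/-- The squared Frobenius norm. -/
def frobSq {n : ℕ} (M : Matrix (Fin n) (Fin n) ℝ) : ℝ := ∑ i, ∑ j, M i j ^ 2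

/-- Step 2: `Q` minimizes `‖T - Q‖_F²` among the matrices of rank at most `k`. -/
def IsBestLowRank {n : ℕ} (k : ℕ) (T Q : Matrix (Fin n) (Fin n) ℝ) : Prop :=
  Q.rank ≤ k ∧ ∀ R : Matrix (Fin n) (Fin n) ℝ, R.rank ≤ k → frobSq (T - Q) ≤ frobSq (T - R)

/-- The `ℓ₁` norm of a vector. -/
def l1 {n : ℕ} (v : Fin n → ℝ) : ℝ := ∑ j, |v j|

open scoped Classical in
/-- The weighted `k`-medians objective
`∑_u min_v ∑_{i ∉ S₀, z i = u} ‖Q_i‖₁ ‖Q_i / ‖Q_i‖₁ - v‖₁`, with `S₀ = {i | ‖Q_i‖₁ = 0}`.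
A label is an element of `Fin k`, or `none` (the label `0`). -/
def kMediansCost {n k : ℕ} (Q : Matrix (Fin n) (Fin n) ℝ) (z : Fin n → Option (Fin k)) : ℝ :=
  ∑ u : Fin k, ⨅ v : Fin n → ℝ,
    ∑ i with l1 (Q i) ≠ 0 ∧ z i = some u, l1 (Q i) * l1 ((l1 (Q i))⁻¹ • Q i - v)

/-- `zhat` is a possible output of weighted `k`-medians clustering with tuning parameter `τ` and
slack `ε`, applied to the adjacency matrix `A`: the nodes of `S₀` get the label `0` (`none`), the
others get labels in `Fin k` that solve the `k`-medians problem up to a factor `1 + ε`. -/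
def IsClusteringOutput {n k : ℕ} (τ ε : ℝ) (A : Matrix (Fin n) (Fin n) ℝ)
    (zhat : Fin n → Option (Fin k)) : Prop :=
  ∃ Q : Matrix (Fin n) (Fin n) ℝ, IsBestLowRank k (trim τ A) Q ∧
    (∀ i, zhat i = none ↔ l1 (Q i) = 0) ∧
    ∀ z' : Fin n → Fin k,
      kMediansCost Q zhat ≤ (1 + ε) * kMediansCost Q (fun i => some (z' i))

open scoped Classical in
/-- `min_π ∑_{i : zhat(i) ≠ π(z(i))} θ_i`, over all permutations `π` of the `k` labels. -/
def misclassLoss {n k : ℕ} (θ : Fin n → ℝ) (z : Fin n → Fin k) (zhat : Fin n → Option (Fin k)) :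
    ℝ :=
  ⨅ π : Equiv.Perm (Fin k), ∑ i with zhat i ≠ some (π (z i)), θ i

end

end DCBM

/-!
The theorem combines a spectral bound for the trimmed adjacency matrix with a perturbation argument
for low-rank approximation and `k`-medians.

**Spectral bound.** Let `4^L` be of the order of `n p ‖θ‖² + 1`, so that `P_{ij} ≤ 4^L / n`. The
trimmed matrix is within `O(2^L)` of `P` in operator norm. A net argument
(`opBound_of_latticeBall`) reduces this to bilinear forms `∑ m_i m'_j (A_{ij} - P_{ij})` with
lattice vectors `m, m'`. On the light pairs `|m_i m'_j| ≤ 16 · 2^L`, a Chernoff bound beats the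
number of lattice vectors (`IsRandomGraph.measure_not_lightBound_le`). On the heavy pairs, the mean
is negligible and `A` is controlled by the bounded degrees of the trimmed graph together with a
discrepancy property for the edge counts between vertex sets
(`IsRandomGraph.measure_not_discrepancyBound_le`, `DiscrepancyBound.sum_heavy_le`). The
discrepancy property is kept in linearized form, with the Chernoff parameter free: after a dyadic
decomposition of `m` and `m'` the parameter is chosen as a function of the levels alone, and the
resulting double series sums to `O(n 2^L)`. Applied to the set of trimmed nodes, the same property
shows that trimming removes few nodes (`DiscrepancyBound.card_trimmed_le`).

**Low rank.** The matrix `R = (θ_i θ_j B_{z(i) z(j)})` with its diagonal filled in has rank at most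
`k`. Hence a best rank-`k` approximation `Q` of the trimmed matrix satisfies
`‖Q - R‖_F² ≤ 2 ⟨T - R, Q - R⟩ ≤ 2 √(2k) ‖T - R‖ ‖Q - R‖_F`
(`IsBestLowRank.sqrt_frobSq_sub_le`), and no gap between eigenvalues is needed.

**Clustering.** The rows of `R` are multiples of `k` profiles, one for each community, whose mutual
`ℓ₁` distances are at least of the order of `(p - q) / (p k)` (`rowProfile_separated`). The true
labelling has `k`-medians cost at most `2 ∑ ‖Q_i - R_i‖₁`, so for an approximate solution all nodes
outside a set `S` of small weight lie close to the center of their cluster (`exists_bad_set`).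
Outside `S`, equal labels mean equal communities. A community may be contained in `S`, and another
one may then carry two labels; a counting argument shows that the best permutation of the labels
still errs on a weight of the order of that of `S` (`misclassLoss_le`), without any assumption on
the size of the bound.
-/

namespace DCBM

/-! ### A Chernoff bound for weighted edge counts -/

/-- A sum over ordered pairs with vanishing diagonal, as a sum over the pairs `i < j`. -/
lemma sum_sum_eq_sum_lt {n : ℕ} (f : Fin n → Fin n → ℝ) (hf : ∀ i, f i i = 0) :
    ∑ i, ∑ j, f i j =
      ∑ e : {e : Fin n × Fin n // e.1 < e.2}, (f e.1.1 e.1.2 + f e.1.2 e.1.1) := by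
  have hsub (g : Fin n → Fin n → ℝ) :
      ∑ e : {e : Fin n × Fin n // e.1 < e.2}, g e.1.1 e.1.2 =
        ∑ i, ∑ j, if i < j then g i j else 0 := by
    rw [← Finset.sum_product', Finset.univ_product_univ, ← Finset.sum_filter]
    exact (Finset.sum_subtype _ (fun e => by simp) (fun e : Fin n × Fin n => g e.1 e.2)).symm
  rw [Finset.sum_add_distrib, hsub f, hsub (fun i j => f j i),
    Finset.sum_comm (f := fun i j => if i < j then f j i else 0), ← Finset.sum_add_distrib]
  refine Finset.sum_congr rfl fun i _ => ?_
  rw [← Finset.sum_add_distrib]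
  refine Finset.sum_congr rfl fun j _ => ?_
  rcases lt_trichotomy i j with h | rfl | h
  · simp [h, h.not_gt]
  · simp [hf]
  · simp [h, h.not_gt]

section RandomGraph

variable {n : ℕ} {Ω : Type*} [MeasurableSpace Ω] {μ : Measure Ω}
  {P : Matrix (Fin n) (Fin n) ℝ} {A : Ω → Matrix (Fin n) (Fin n) ℝ}

lemma IsRandomGraph.exp_mul_apply (hA : IsRandomGraph μ P A) (c : ℝ) (i j : Fin n) (ω : Ω) :
    Real.exp (c * A ω i j) = 1 + A ω i j * (Real.exp c - 1) := by
  rcases hA.zero_or_one ω i j with h | h <;> simp [h]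

lemma IsRandomGraph.integral_apply (hA : IsRandomGraph μ P A) {i j : Fin n} (hij : i ≠ j)
    (hP : 0 ≤ P i j) : ∫ ω, A ω i j ∂μ = P i j := by
  have h1 : (fun ω => A ω i j) = Set.indicator {ω | A ω i j = 1} (fun _ => (1 : ℝ)) := by
    funext ω
    rcases hA.zero_or_one ω i j with h | h <;> simp [Set.indicator, h]
  have hm : MeasurableSet {ω | A ω i j = 1} := hA.measurable i j (measurableSet_singleton 1)
  rw [h1, integral_indicator_const _ hm, Measure.real, hA.prob i j hij]
  simp [hP]

variable [IsProbabilityMeasure μ]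

lemma IsRandomGraph.integrable_apply (hA : IsRandomGraph μ P A) (i j : Fin n) :
    Integrable (fun ω => A ω i j) μ := by
  refine Integrable.of_bound (hA.measurable i j).aestronglyMeasurable 1 (ae_of_all _ fun ω => ?_)
  rcases hA.zero_or_one ω i j with h | h <;> simp [h]

lemma IsRandomGraph.mgf_apply_le (hA : IsRandomGraph μ P A) {i j : Fin n} (hij : i ≠ j)
    (hP : 0 ≤ P i j) (c : ℝ) :
    mgf (fun ω => c * A ω i j) μ 1 ≤ Real.exp (P i j * (Real.exp c - 1)) := by
  have : mgf (fun ω => c * A ω i j) μ 1 = 1 + P i j * (Real.exp c - 1) := by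
    simp only [mgf, one_mul, hA.exp_mul_apply]
    rw [integral_add (integrable_const _) ((hA.integrable_apply i j).mul_const _),
      integral_mul_const, hA.integral_apply hij hP]
    simp
  rw [this, add_comm]
  exact Real.add_one_le_exp _

/-- **Chernoff bound** for `∑ w_{ij} A_{ij}`. Each edge is counted with weight `w_{ij} + w_{ji}`;
convexity of the exponential turns the resulting exponent into a sum over ordered pairs. -/
theorem IsRandomGraph.measure_le_sum_le (hA : IsRandomGraph μ P A) (hP : ∀ i j, 0 ≤ P i j)
    (hPs : ∀ i j, P i j = P j i) (hPd : ∀ i, P i i = 0) (w : Fin n → Fin n → ℝ) (r : ℝ) :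
    μ.real {ω | r ≤ ∑ i, ∑ j, w i j * A ω i j} ≤
      Real.exp (-r + 1 / 2 * ∑ i, ∑ j, P i j * (Real.exp (2 * w i j) - 1)) := by
  set E := {e : Fin n × Fin n // e.1 < e.2}
  set X : E → Ω → ℝ := fun e ω => (w e.1.1 e.1.2 + w e.1.2 e.1.1) * A ω e.1.1 e.1.2 with hX
  have hindep : iIndepFun X μ :=
    hA.indep.comp (fun e x => (w e.1.1 e.1.2 + w e.1.2 e.1.1) * x)
      (fun e => measurable_const_mul _)
  have hmeas : ∀ e, Measurable (X e) := fun e => (hA.measurable _ _).const_mul _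
  have hsum (ω : Ω) : ∑ i, ∑ j, w i j * A ω i j = (∑ e, X e) ω := by
    rw [sum_sum_eq_sum_lt _ (fun i => by simp [hA.diag]), Finset.sum_apply]
    refine Finset.sum_congr rfl fun e _ => ?_
    rw [hX, hA.symm ω e.1.2 e.1.1]
    ring
  have hint : Integrable (fun ω => Real.exp (1 * (∑ e, X e) ω)) μ := by
    refine hindep.integrable_exp_mul_sum hmeas fun e _ => ?_
    simp only [one_mul, hX, hA.exp_mul_apply]
    exact (integrable_const _).add ((hA.integrable_apply _ _).mul_const _)
  have hmgf : mgf (∑ e, X e) μ 1 ≤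
      Real.exp (1 / 2 * ∑ i, ∑ j, P i j * (Real.exp (2 * w i j) - 1)) := by
    rw [hindep.mgf_sum hmeas, sum_sum_eq_sum_lt _ (fun i => by simp [hPd]), Finset.mul_sum,
      Real.exp_sum]
    refine Finset.prod_le_prod (fun _ _ => mgf_nonneg) fun e _ => ?_
    refine (hA.mgf_apply_le e.2.ne (hP _ _) _).trans (Real.exp_le_exp.2 ?_)
    rw [hPs e.1.2 e.1.1]
    -- `exp (a + b) ≤ (exp (2a) + exp (2b)) / 2`
    have h : Real.exp (w e.1.1 e.1.2 + w e.1.2 e.1.1) ≤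
        1 / 2 * (Real.exp (2 * w e.1.1 e.1.2) + Real.exp (2 * w e.1.2 e.1.1)) := by
      rw [Real.exp_add, two_mul, two_mul, Real.exp_add, Real.exp_add]
      nlinarith [sq_nonneg (Real.exp (w e.1.1 e.1.2) - Real.exp (w e.1.2 e.1.1))]
    nlinarith [mul_le_mul_of_nonneg_left h (hP e.1.1 e.1.2)]
  calc μ.real {ω | r ≤ ∑ i, ∑ j, w i j * A ω i j}
      = μ.real {ω | r ≤ (∑ e, X e) ω} := by simp only [hsum]
    _ ≤ Real.exp (-1 * r) * mgf (∑ e, X e) μ 1 :=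
        measure_ge_le_exp_mul_mgf r zero_le_one hint
    _ ≤ _ := by
        rw [Real.exp_add, neg_one_mul]
        gcongr

end RandomGraph

/-! ### Light pairs: a uniform bound over lattice vectors -/

/-- The integer vectors of squared norm at most `16 n`. Divided by `4 √n` they form a
`1/4`-net of the Euclidean unit ball. -/
noncomputable def latticeBall (n : ℕ) : Finset (Fin n → ℤ) :=
  (Fintype.piFinset fun _ => Finset.Icc (-(16 * n : ℤ)) (16 * n)).filter
    fun m => ∑ i, m i ^ 2 ≤ 16 * n

lemma mem_latticeBall {n : ℕ} {m : Fin n → ℤ} :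
    m ∈ latticeBall n ↔ ∑ i, m i ^ 2 ≤ 16 * n := by
  simp only [latticeBall, Finset.mem_filter, Fintype.mem_piFinset, Finset.mem_Icc,
    and_iff_right_iff_imp]
  intro h i
  have h1 : m i ^ 2 ≤ 16 * n :=
    (Finset.single_le_sum (f := fun i => m i ^ 2) (fun _ _ => sq_nonneg _)
      (Finset.mem_univ i)).trans h
  constructor <;> nlinarith [Int.natCast_nonneg n]

lemma sum_exp_neg_sq_le (N : ℕ) :
    ∑ m ∈ Finset.Icc (-(N : ℤ)) N, Real.exp (-(m : ℝ) ^ 2) ≤ Real.exp 2 := by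
  have hE : (2 : ℝ) ≤ Real.exp 1 := by linarith [Real.add_one_le_exp (1 : ℝ)]
  -- compare with a geometric series
  have key : ∀ N : ℕ, ∑ m ∈ Finset.Icc (-(N : ℤ)) N, Real.exp (-(m : ℝ) ^ 2) ≤
      3 - 2 * (1 / 2) ^ N := by
    intro N
    induction N with
    | zero => norm_num
    | succ N ih =>
      have hI : Finset.Icc (-((N + 1 : ℕ) : ℤ)) ((N + 1 : ℕ) : ℤ) =
          insert (-((N + 1 : ℕ) : ℤ)) (insert (((N + 1 : ℕ) : ℤ))
            (Finset.Icc (-(N : ℤ)) N)) := by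
        ext x
        simp only [Finset.mem_Icc, Finset.mem_insert]
        omega
      have hb : Real.exp (-((N : ℝ) + 1) ^ 2) ≤ (1 / 2) ^ (N + 1) := by
        calc Real.exp (-((N : ℝ) + 1) ^ 2) ≤ Real.exp (-((N + 1 : ℕ) : ℝ)) := by
              apply Real.exp_le_exp.2
              push_cast
              nlinarith [Nat.cast_nonneg (α := ℝ) N]
          _ = (1 / Real.exp 1) ^ (N + 1) := by
              rw [Real.exp_neg, ← Real.exp_one_pow, one_div, inv_pow]
          _ ≤ _ := by gcongr
      rw [hI, Finset.sum_insert, Finset.sum_insert]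
      · push_cast
        rw [neg_sq]
        have : (2 : ℝ) * (1 / 2) ^ (N + 1) = (1 / 2) ^ N := by rw [pow_succ]; ring
        linarith
      · simp
      · simp only [Finset.mem_Icc, Finset.mem_insert]; omega
  have : (0 : ℝ) ≤ 2 * (1 / 2) ^ N := by positivity
  have h2 : Real.exp 2 = Real.exp 1 * Real.exp 1 := by rw [← Real.exp_add]; norm_num
  nlinarith [key N]

/-- The lattice ball is counted by giving the vector `m` the weight `exp (16 n - ∑ m_i²) ≥ 1`. -/
lemma card_latticeBall_le (n : ℕ) : ((latticeBall n).card : ℝ) ≤ Real.exp (18 * n) := by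
  have h1 : ((latticeBall n).card : ℝ) ≤
      ∑ m ∈ latticeBall n, Real.exp (16 * n) * ∏ i, Real.exp (-(m i : ℝ) ^ 2) := by
    rw [Finset.card_eq_sum_ones, Nat.cast_sum]
    refine Finset.sum_le_sum fun m hm => ?_
    rw [← Real.exp_sum, ← Real.exp_add, Nat.cast_one]
    apply Real.one_le_exp
    have := mem_latticeBall.1 hm
    have h : (∑ i, (m i : ℝ) ^ 2) ≤ 16 * n := by exact_mod_cast this
    rw [Finset.sum_neg_distrib]
    linarith
  refine h1.trans ((Finset.sum_le_sum_of_subset_of_nonneg (Finset.filter_subset _ _)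
    fun _ _ _ => by positivity).trans ?_)
  rw [← Finset.mul_sum, ← Finset.prod_univ_sum
    (fun _ : Fin n => Finset.Icc (-(16 * n : ℤ)) (16 * n))
    (fun _ (x : ℤ) => Real.exp (-(x : ℝ) ^ 2))]
  calc _ ≤ Real.exp (16 * n) * ∏ i : Fin n, Real.exp 2 := by
        gcongr with i
        have := sum_exp_neg_sq_le (16 * n)
        push_cast at this
        exact this
    _ = _ := by
        rw [Finset.prod_const, Finset.card_univ, Fintype.card_fin, ← Real.exp_nat_mul,
          ← Real.exp_add]
        ring_nf

/-- The deviation of `A` from `P` is controlled on the light pairs `|m_i m'_j| ≤ 16 · 2^L`,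
uniformly over lattice vectors. -/
def LightBound {n : ℕ} (L : ℕ) (P A : Matrix (Fin n) (Fin n) ℝ) : Prop :=
  ∀ m ∈ latticeBall n, ∀ m' ∈ latticeBall n,
    ∑ i, ∑ j, (if |(m i * m' j : ℝ)| ≤ 16 * 2 ^ L then (m i * m' j : ℝ) else 0) *
      (A i j - P i j) ≤ 1280 * 2 ^ L * n

lemma sum_sq_le_of_mem {n : ℕ} {m : Fin n → ℤ} (hm : m ∈ latticeBall n) :
    ∑ i, (m i : ℝ) ^ 2 ≤ 16 * n := by
  exact_mod_cast mem_latticeBall.1 hm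

theorem IsRandomGraph.measure_not_lightBound_le {n : ℕ} {Ω : Type*} [MeasurableSpace Ω]
    {μ : Measure Ω} [IsProbabilityMeasure μ] {P : Matrix (Fin n) (Fin n) ℝ}
    {A : Ω → Matrix (Fin n) (Fin n) ℝ} (hA : IsRandomGraph μ P A) (hP : ∀ i j, 0 ≤ P i j)
    (hPs : ∀ i j, P i j = P j i) (hPd : ∀ i, P i i = 0) (L : ℕ)
    (hPL : ∀ i j, P i j ≤ 4 ^ L / n) :
    μ.real {ω | ¬ LightBound L P (A ω)} ≤ Real.exp (-(3 * n : ℝ)) := by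
  -- the Chernoff parameter `1 / (32 · 2^L)` is the largest keeping all exponents in `[-1, 1]`; the
  -- level `40 n` leaves `exp (-39 n)`, enough for the at most `exp (36 n)` pairs of lattice vectors
  set w : (Fin n → ℤ) → (Fin n → ℤ) → Fin n → Fin n → ℝ := fun m m' i j =>
    (if |(m i * m' j : ℝ)| ≤ 16 * 2 ^ L then (m i * m' j : ℝ) else 0) / (32 * 2 ^ L) with hw
  have h2L : (0 : ℝ) < 2 ^ L := by positivity
  have h4L : (4 : ℝ) ^ L = 2 ^ L * 2 ^ L := by rw [← mul_pow]; norm_num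
  have hw1 : ∀ m m' i j, |2 * w m m' i j| ≤ 1 := by
    intro m m' i j
    simp only [hw]
    split_ifs with h
    · rw [← mul_div_assoc, abs_div, abs_mul, abs_two,
        abs_of_pos (by positivity : (0 : ℝ) < 32 * 2 ^ L), div_le_one (by positivity)]
      linarith
    · simp
  have hw2 : ∀ m ∈ latticeBall n, ∀ m' ∈ latticeBall n,
      ∑ i, ∑ j, P i j * w m m' i j ^ 2 ≤ n / 4 := by
    intro m hm m' hm'
    rcases Nat.eq_zero_or_pos n with rfl | hn
    · simp
    have hn' : (0 : ℝ) < n := by exact_mod_cast hn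
    calc ∑ i, ∑ j, P i j * w m m' i j ^ 2
        ≤ ∑ i, ∑ j, 1 / (1024 * n) * ((m i : ℝ) ^ 2 * (m' j : ℝ) ^ 2) := by
          refine Finset.sum_le_sum fun i _ => Finset.sum_le_sum fun j _ => ?_
          have h1 : w m m' i j ^ 2 ≤ (m i : ℝ) ^ 2 * (m' j : ℝ) ^ 2 / (32 * 2 ^ L) ^ 2 := by
            simp only [hw, div_pow]
            gcongr
            split_ifs
            · rw [mul_pow]
            · rw [zero_pow two_ne_zero]; positivity
          calc P i j * w m m' i j ^ 2
              ≤ 4 ^ L / n * ((m i : ℝ) ^ 2 * (m' j : ℝ) ^ 2 / (32 * 2 ^ L) ^ 2) := by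
                gcongr
                exact hPL i j
            _ = _ := by
                rw [h4L]
                field_simp
                norm_num
      _ = 1 / (1024 * n) * ((∑ i, (m i : ℝ) ^ 2) * ∑ j, (m' j : ℝ) ^ 2) := by
          rw [Finset.sum_mul_sum]
          simp only [Finset.mul_sum]
      _ ≤ 1 / (1024 * n) * ((16 * n) * (16 * n)) := by
          gcongr
          · exact sum_sq_le_of_mem hm
          · exact sum_sq_le_of_mem hm'
      _ = n / 4 := by field_simp; norm_num
  have hone : ∀ m ∈ latticeBall n, ∀ m' ∈ latticeBall n,
      μ.real {ω | 40 * n + ∑ i, ∑ j, w m m' i j * P i j ≤ ∑ i, ∑ j, w m m' i j * A ω i j} ≤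
        Real.exp (-(39 * n : ℝ)) := by
    intro m hm m' hm'
    refine (hA.measure_le_sum_le hP hPs hPd _ _).trans (Real.exp_le_exp.2 ?_)
    have h1 : ∑ i, ∑ j, P i j * (Real.exp (2 * w m m' i j) - 1) ≤
        ∑ i, ∑ j, (2 * (w m m' i j * P i j) + 4 * (P i j * w m m' i j ^ 2)) := by
      refine Finset.sum_le_sum fun i _ => Finset.sum_le_sum fun j _ => ?_
      have := (abs_le.1 (Real.abs_exp_sub_one_sub_id_le (hw1 m m' i j))).2
      nlinarith [mul_le_mul_of_nonneg_left this (hP i j)]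
    simp only [Finset.sum_add_distrib, ← Finset.mul_sum] at h1
    have := hw2 m hm m' hm'
    have hn : (0 : ℝ) ≤ n := Nat.cast_nonneg n
    linarith
  have hsub : {ω | ¬ LightBound L P (A ω)} ⊆ ⋃ e ∈ latticeBall n ×ˢ latticeBall n,
      {ω | 40 * n + ∑ i, ∑ j, w e.1 e.2 i j * P i j ≤ ∑ i, ∑ j, w e.1 e.2 i j * A ω i j} := by
    intro ω hω
    simp only [LightBound, Set.mem_ofPred_eq, not_forall, not_le] at hω
    obtain ⟨m, hm, m', hm', h⟩ := hω
    simp only [Set.mem_iUnion, Finset.mem_product]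
    refine ⟨(m, m'), ⟨hm, hm'⟩, ?_⟩
    have h3 : ∑ i, ∑ j, (if |(m i * m' j : ℝ)| ≤ 16 * 2 ^ L then (m i * m' j : ℝ) else 0) *
        (A ω i j - P i j) = 32 * 2 ^ L * (∑ i, ∑ j, w m m' i j * A ω i j -
          ∑ i, ∑ j, w m m' i j * P i j) := by
      rw [← Finset.sum_sub_distrib, Finset.mul_sum]
      refine Finset.sum_congr rfl fun i _ => ?_
      rw [← Finset.sum_sub_distrib, Finset.mul_sum]
      refine Finset.sum_congr rfl fun j _ => ?_
      simp only [hw]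
      field_simp
    rw [h3] at h
    have : (40 : ℝ) * n < ∑ i, ∑ j, w m m' i j * A ω i j - ∑ i, ∑ j, w m m' i j * P i j := by
      by_contra hcon
      have := mul_le_mul_of_nonneg_left (not_lt.1 hcon) (by positivity : (0 : ℝ) ≤ 32 * 2 ^ L)
      linarith
    show 40 * n + ∑ i, ∑ j, w m m' i j * P i j ≤ ∑ i, ∑ j, w m m' i j * A ω i j
    linarith
  calc μ.real {ω | ¬ LightBound L P (A ω)}
      ≤ ∑ e ∈ latticeBall n ×ˢ latticeBall n, μ.real {ω | 40 * n +
          ∑ i, ∑ j, w e.1 e.2 i j * P i j ≤ ∑ i, ∑ j, w e.1 e.2 i j * A ω i j} :=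
        (measureReal_mono hsub (measure_ne_top _ _)).trans (measureReal_biUnion_finset_le _ _)
    _ ≤ ∑ e ∈ latticeBall n ×ˢ latticeBall n, Real.exp (-(39 * n : ℝ)) :=
        Finset.sum_le_sum fun e he =>
          hone _ (Finset.mem_product.1 he).1 _ (Finset.mem_product.1 he).2
    _ = (latticeBall n).card * (latticeBall n).card * Real.exp (-(39 * n : ℝ)) := by
        rw [Finset.sum_const, Finset.card_product, nsmul_eq_mul, Nat.cast_mul]
    _ ≤ Real.exp (18 * n) * Real.exp (18 * n) * Real.exp (-(39 * n : ℝ)) := by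
        gcongr <;> exact card_latticeBall_le n
    _ = Real.exp (-(3 * n : ℝ)) := by
        rw [← Real.exp_add, ← Real.exp_add]; ring_nf

/-! ### Discrepancy: edge counts between all pairs of vertex sets -/

/-- The entropy `a log (e n / a)` of the family of `a`-element subsets of an `n`-element set. For
`a = 0` it is `0`, whatever the value assigned to the logarithm. -/
noncomputable def subsetEntropy (n a : ℕ) : ℝ := a * (1 + Real.log (n / a))

lemma subsetEntropy_zero (n : ℕ) : subsetEntropy n 0 = 0 := by simp [subsetEntropy]

lemma subsetEntropy_nonneg {n a : ℕ} (h : a ≤ n) : 0 ≤ subsetEntropy n a := by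
  rcases Nat.eq_zero_or_pos a with rfl | ha
  · simp [subsetEntropy]
  have ha' : (0 : ℝ) < a := by exact_mod_cast ha
  have : 0 ≤ Real.log ((n : ℝ) / a) :=
    Real.log_nonneg ((one_le_div ha').2 (by exact_mod_cast h))
  unfold subsetEntropy
  positivity

lemma subsetEntropy_le {n a : ℕ} (h : a ≤ n) : subsetEntropy n a ≤ n := by
  rcases Nat.eq_zero_or_pos a with rfl | ha
  · simp [subsetEntropy]
  have ha' : (0 : ℝ) < a := by exact_mod_cast ha
  have hn' : (0 : ℝ) < n := by exact_mod_cast ha.trans_le h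
  have := Real.log_le_sub_one_of_pos (div_pos hn' ha')
  calc subsetEntropy n a ≤ a * (n / a) := by
        unfold subsetEntropy
        gcongr
        linarith
    _ = n := by field_simp

lemma log_le_subsetEntropy {n a : ℕ} (ha : 1 ≤ a) (h : a ≤ n) :
    Real.log n ≤ subsetEntropy n a := by
  have ha' : (1 : ℝ) ≤ a := by exact_mod_cast ha
  have h' : (a : ℝ) ≤ n := by exact_mod_cast h
  have h1 : Real.log a ≤ Real.log n := Real.log_le_log (by linarith) h'
  have h2 : Real.log a ≤ a - 1 := Real.log_le_sub_one_of_pos (by linarith)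
  have h3 : 0 ≤ Real.log a := Real.log_nonneg ha'
  unfold subsetEntropy
  rw [Real.log_div (by linarith) (by linarith)]
  nlinarith [mul_nonneg (sub_nonneg.2 ha') (sub_nonneg.2 h1)]

lemma choose_le_exp_subsetEntropy {n a : ℕ} (ha : 1 ≤ a) (h : a ≤ n) :
    (n.choose a : ℝ) ≤ Real.exp (subsetEntropy n a) := by
  have ha' : (0 : ℝ) < a := by exact_mod_cast ha
  have hn' : (0 : ℝ) < n := by exact_mod_cast (ha.trans h)
  have h1 := Real.pow_div_factorial_le_exp (a : ℝ) ha'.le a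
  have h2 : (n.choose a : ℝ) ≤ (n : ℝ) ^ a / (a.factorial : ℝ) := Nat.choose_le_pow_div a n
  have h3 : Real.exp (subsetEntropy n a) = Real.exp a * ((n : ℝ) / a) ^ a := by
    rw [subsetEntropy, mul_add, mul_one, Real.exp_add, Real.exp_nat_mul,
      Real.exp_log (div_pos hn' ha')]
  rw [h3]
  refine h2.trans ?_
  calc (n : ℝ) ^ a / (a.factorial : ℝ)
      = (a : ℝ) ^ a / (a.factorial : ℝ) * ((n : ℝ) / a) ^ a := by
        rw [div_pow]; field_simp
    _ ≤ _ := by gcongr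

lemma sum_exp_neg_subsetEntropy_le (n : ℕ) :
    ∑ I : Finset (Fin n), (if I = ∅ then 0 else Real.exp (-4 * subsetEntropy n I.card)) ≤
      n * (1 / (n : ℝ) ^ 3) := by
  have h0 : ∀ I : Finset (Fin n), (if I = ∅ then 0 else Real.exp (-4 * subsetEntropy n I.card)) =
      (fun a : ℕ => if a = 0 then (0 : ℝ) else Real.exp (-4 * subsetEntropy n a)) I.card := by
    intro I
    simp only [Finset.card_eq_zero]
  simp only [h0]
  rw [← Finset.powerset_univ, Finset.sum_powerset_apply_card
    (fun a : ℕ => if a = 0 then (0 : ℝ) else Real.exp (-4 * subsetEntropy n a)),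
    Finset.card_univ, Fintype.card_fin, Finset.sum_range_succ']
  simp only [if_true, smul_zero, add_zero, Nat.add_eq_zero_iff, one_ne_zero, and_false, if_false]
  refine (Finset.sum_le_card_nsmul _ _ (1 / (n : ℝ) ^ 3) fun a ha => ?_).trans ?_
  · have hle : a + 1 ≤ n := Finset.mem_range.1 ha
    have hn' : (0 : ℝ) < n := by exact_mod_cast (Nat.succ_pos a).trans_le hle
    have h1 := choose_le_exp_subsetEntropy (Nat.le_add_left 1 a) hle
    have h2 := log_le_subsetEntropy (Nat.le_add_left 1 a) hle
    rw [nsmul_eq_mul]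
    calc _ ≤ Real.exp (subsetEntropy n (a + 1)) * Real.exp (-4 * subsetEntropy n (a + 1)) := by
          gcongr
      _ = Real.exp (-(3 * subsetEntropy n (a + 1))) := by rw [← Real.exp_add]; ring_nf
      _ ≤ Real.exp (-((3 : ℕ) * Real.log n)) := by
          apply Real.exp_le_exp.2
          push_cast
          linarith
      _ = 1 / (n : ℝ) ^ 3 := by
          rw [Real.exp_neg, Real.exp_nat_mul, Real.exp_log hn', one_div]
  · simp

/-- A linearized discrepancy property. Optimizing over the Chernoff parameter `(j / 2) log 2`
recovers the usual dichotomy between `e(I, J) ≲ |I| |J| 4^L / n` and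
`e(I, J) log (e(I, J) n / (|I| |J| 4^L)) ≲ entropy`; keeping `j` free avoids the dichotomy. The
factor `4` in front of the entropies leaves room for a union bound over `I` and `J`. -/
def DiscrepancyBound {n : ℕ} (L : ℕ) (A : Matrix (Fin n) (Fin n) ℝ) : Prop :=
  ∀ I J : Finset (Fin n), ∀ j ∈ Finset.range (16 * n),
    (j / 2 * Real.log 2) * ∑ a ∈ I, ∑ b ∈ J, A a b ≤
      1 / 2 * (I.card * J.card * (4 ^ L / n) * 2 ^ j) +
        4 * (subsetEntropy n I.card + subsetEntropy n J.card)

theorem IsRandomGraph.measure_not_discrepancyBound_le {n : ℕ} {Ω : Type*} [MeasurableSpace Ω]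
    {μ : Measure Ω} [IsProbabilityMeasure μ] {P : Matrix (Fin n) (Fin n) ℝ}
    {A : Ω → Matrix (Fin n) (Fin n) ℝ} (hA : IsRandomGraph μ P A) (hP : ∀ i j, 0 ≤ P i j)
    (hPs : ∀ i j, P i j = P j i) (hPd : ∀ i, P i i = 0) (L : ℕ)
    (hPL : ∀ i j, P i j ≤ 4 ^ L / n) :
    μ.real {ω | ¬ DiscrepancyBound L (A ω)} ≤ 16 / (n : ℝ) ^ 3 := by
  classical
  set R : Finset (Fin n) → Finset (Fin n) → ℕ → ℝ := fun I J j =>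
    1 / 2 * (I.card * J.card * (4 ^ L / n) * 2 ^ j) +
        4 * (subsetEntropy n I.card + subsetEntropy n J.card) with hR
  set g : Finset (Fin n) → ℝ := fun I =>
    if I = ∅ then 0 else Real.exp (-4 * subsetEntropy n I.card) with hg
  have hcard (I : Finset (Fin n)) : I.card ≤ n := by simpa using I.card_le_univ
  have hone (I J : Finset (Fin n)) (j : ℕ) :
      μ.real {ω | R I J j < (j / 2 * Real.log 2) * ∑ a ∈ I, ∑ b ∈ J, A ω a b} ≤ g I * g J := by
    by_cases hI : I = ∅
    · have hempty : {ω | R I J j < (j / 2 * Real.log 2) * ∑ a ∈ I, ∑ b ∈ J, A ω a b} = ∅ := by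
        refine Set.eq_empty_of_forall_notMem fun ω => ?_
        rw [Set.mem_ofPred_eq]
        have := subsetEntropy_nonneg (hcard J)
        simp only [hR, hI, Finset.sum_empty, mul_zero, not_lt, Finset.card_empty,
          subsetEntropy_zero]
        simp; positivity
      rw [hempty]
      simp [hg, hI]
    by_cases hJ : J = ∅
    · have hempty : {ω | R I J j < (j / 2 * Real.log 2) * ∑ a ∈ I, ∑ b ∈ J, A ω a b} = ∅ := by
        refine Set.eq_empty_of_forall_notMem fun ω => ?_
        rw [Set.mem_ofPred_eq]
        have := subsetEntropy_nonneg (hcard I)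
        simp only [hR, hJ, Finset.sum_empty, mul_zero, not_lt, Finset.card_empty,
          subsetEntropy_zero, Finset.sum_const_zero]
        simp; positivity
      rw [hempty]
      simp [hg, hJ]
    set w : Fin n → Fin n → ℝ := fun a b =>
      if a ∈ I ∧ b ∈ J then j / 2 * Real.log 2 else 0 with hw
    have hsum (f : Fin n → Fin n → ℝ) :
        ∑ a, ∑ b, (if a ∈ I ∧ b ∈ J then f a b else 0) = ∑ a ∈ I, ∑ b ∈ J, f a b := by
      simp only [ite_and]
      simp
    have hwA (ω : Ω) : (j / 2 * Real.log 2) * ∑ a ∈ I, ∑ b ∈ J, A ω a b =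
        ∑ a, ∑ b, w a b * A ω a b := by
      simp only [hw, ite_mul, zero_mul]
      rw [hsum, Finset.mul_sum]
      simp only [Finset.mul_sum]
    have hexp : Real.exp (2 * (j / 2 * Real.log 2)) = 2 ^ j := by
      rw [← mul_assoc, mul_div_cancel₀ _ two_ne_zero, Real.exp_nat_mul, Real.exp_log two_pos]
    have hwP : ∑ a, ∑ b, P a b * (Real.exp (2 * w a b) - 1) ≤
        I.card * J.card * (4 ^ L / n) * 2 ^ j := by
      calc ∑ a, ∑ b, P a b * (Real.exp (2 * w a b) - 1)
          ≤ ∑ a, ∑ b, (if a ∈ I ∧ b ∈ J then (4 : ℝ) ^ L / n * 2 ^ j else 0) := by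
            refine Finset.sum_le_sum fun a _ => Finset.sum_le_sum fun b _ => ?_
            simp only [hw]
            split_ifs
            · rw [hexp]
              have := hP a b
              have := hPL a b
              calc P a b * (2 ^ j - 1) ≤ P a b * 2 ^ j := by
                    gcongr; linarith
                _ ≤ _ := by gcongr
            · simp
        _ = _ := by
            rw [hsum]
            simp [mul_assoc]
    calc _ ≤ μ.real {ω | R I J j ≤ ∑ a, ∑ b, w a b * A ω a b} := by
          refine measureReal_mono (fun ω hω => ?_) (measure_ne_top _ _)
          have := le_of_lt (show R I J j < _ from hω)
          rwa [hwA] at this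
      _ ≤ _ := hA.measure_le_sum_le hP hPs hPd w _
      _ ≤ Real.exp (-4 * subsetEntropy n I.card + -4 * subsetEntropy n J.card) := by
          apply Real.exp_le_exp.2
          simp only [hR]
          linarith
      _ = g I * g J := by simp [hg, hI, hJ, Real.exp_add]
  have hsub : {ω | ¬ DiscrepancyBound L (A ω)} ⊆
      ⋃ e ∈ (Finset.univ : Finset (Finset (Fin n) × Finset (Fin n))) ×ˢ Finset.range (16 * n),
        {ω | R e.1.1 e.1.2 e.2 <
          (e.2 / 2 * Real.log 2) * ∑ a ∈ e.1.1, ∑ b ∈ e.1.2, A ω a b} := by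
    intro ω hω
    simp only [DiscrepancyBound, Set.mem_ofPred_eq, not_forall, not_le] at hω
    obtain ⟨I, J, j, hj, h⟩ := hω
    simp only [Set.mem_iUnion, Finset.mem_product]
    exact ⟨((I, J), j), ⟨Finset.mem_univ _, hj⟩, h⟩
  have hG : 0 ≤ ∑ I, g I := Finset.sum_nonneg fun I _ => by
    simp only [hg]; split_ifs <;> positivity
  calc _ ≤ ∑ e ∈ (Finset.univ : Finset (Finset (Fin n) × Finset (Fin n))) ×ˢ
          Finset.range (16 * n), g e.1.1 * g e.1.2 :=
        ((measureReal_mono hsub (measure_ne_top _ _)).trans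
          (measureReal_biUnion_finset_le _ _)).trans
          (Finset.sum_le_sum fun e _ => hone _ _ _)
    _ = 16 * n * ((∑ I, g I) * ∑ I, g I) := by
        rw [Finset.sum_product_right]
        simp only [Finset.sum_const, Finset.card_range, nsmul_eq_mul]
        rw [Fintype.sum_prod_type, Finset.sum_mul_sum]
        push_cast
        ring
    _ ≤ 16 * n * ((n * (1 / (n : ℝ) ^ 3)) * (n * (1 / (n : ℝ) ^ 3))) := by
        gcongr <;> exact sum_exp_neg_subsetEntropy_le n
    _ = 16 / (n : ℝ) ^ 3 := by
        rcases Nat.eq_zero_or_pos n with rfl | hn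
        · simp
        have hn' : (n : ℝ) ≠ 0 := by exact_mod_cast hn.ne'
        field_simp

/-! ### Heavy pairs: degrees and discrepancy -/

lemma sum_two_pow_div_le {N : ℕ} (hN : 1 ≤ N) :
    ∑ j ∈ Finset.Ico 1 N, (2 : ℝ) ^ j / j ≤ 3 * 2 ^ N / N := by
  induction N, hN using Nat.le_induction with
  | base => simp
  | succ N hN ih =>
    rw [Finset.sum_Ico_succ_top hN]
    have hN' : (1 : ℝ) ≤ N := by exact_mod_cast hN
    rcases hN.eq_or_lt with rfl | h2
    · norm_num
    have h2' : (2 : ℝ) ≤ N := by exact_mod_cast h2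
    refine (add_le_add_left ih _).trans ?_
    rw [← add_div, div_le_div_iff₀ (by positivity) (by positivity)]
    push_cast
    have : (0 : ℝ) < 2 ^ N := by positivity
    rw [pow_succ]
    nlinarith

lemma four_pow_div_mul_subsetEntropy_le {n b t : ℕ} (ht : 1 ≤ t) (hb : b ≤ n) :
    4 ^ t / t * subsetEntropy n b ≤ 6 * (4 ^ t * b) + 2 * n * (1 / 2) ^ t := by
  rcases Nat.eq_zero_or_pos b with rfl | hb0
  · rw [subsetEntropy_zero]
    simp only [mul_zero, Nat.cast_zero, zero_add]
    positivity
  have hb' : (0 : ℝ) < b := by exact_mod_cast hb0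
  have hn' : (0 : ℝ) < n := by exact_mod_cast hb0.trans_le hb
  have ht' : (1 : ℝ) ≤ t := by exact_mod_cast ht
  have ht0 : (0 : ℝ) < t := by linarith
  -- the threshold `64^t` is what makes `4^t √(n b) ≤ n / 2^t` in the second case
  rcases le_or_gt (n : ℝ) (64 ^ t * b) with h | h
  · have h1 : Real.log (n / b) ≤ t * (6 * Real.log 2) := by
      have h64 : (6 : ℝ) * Real.log 2 = Real.log 64 := by
        rw [show (64 : ℝ) = 2 ^ 6 by norm_num, Real.log_pow]; norm_num
      rw [h64, ← Real.log_pow]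
      exact Real.log_le_log (by positivity) ((div_le_iff₀ hb').2 h)
    have h2 : 1 + Real.log (n / b) ≤ 6 * t := by
      nlinarith [Real.log_two_lt_d9]
    calc 4 ^ t / t * subsetEntropy n b ≤ 4 ^ t / t * (b * (6 * t)) := by
          unfold subsetEntropy; gcongr
      _ = 6 * (4 ^ t * b) := by field_simp
      _ ≤ _ := le_add_of_nonneg_right (by positivity)
  · -- here `b` is so small that even the crude bound `log y ≤ 2 √y` is summable in `t`
    set y : ℝ := n / b with hy
    have hy0 : 0 < y := by positivity
    have h1 : 1 + Real.log y ≤ 2 * √y := by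
      have h3 := Real.log_le_sub_one_of_pos (Real.sqrt_pos.2 hy0)
      rw [Real.log_sqrt hy0.le] at h3
      linarith
    have h2 : (b : ℝ) * √y ≤ n / 8 ^ t := by
      apply le_of_sq_le_sq _ (by positivity)
      rw [mul_pow, Real.sq_sqrt hy0.le, div_pow, hy, ← pow_mul, mul_comm t 2, pow_mul]
      rw [le_div_iff₀ (by positivity)]
      norm_num
      calc (b : ℝ) ^ 2 * (n / b) * 64 ^ t = n * (64 ^ t * b) := by field_simp
        _ ≤ n ^ 2 := by rw [sq]; gcongr
    calc 4 ^ t / t * subsetEntropy n b ≤ 4 ^ t / 1 * (2 * (n / 8 ^ t)) := by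
          have h4 : subsetEntropy n b ≤ 2 * (n / 8 ^ t) := by
            unfold subsetEntropy
            nlinarith [mul_le_mul_of_nonneg_left h1 hb'.le]
          have := subsetEntropy_nonneg hb
          gcongr
      _ = 2 * n * (1 / 2) ^ t := by
          rw [show (8 : ℝ) = 4 * 2 by norm_num, mul_pow, div_pow]
          field_simp
          simp
      _ ≤ _ := le_add_of_nonneg_left (by positivity)

/-- The dyadic level set `{i | 2^s ≤ m i < 2^(s+1)}`. -/
def dyadicLevel {n : ℕ} (m : Fin n → ℕ) (s : ℕ) : Finset (Fin n) :=
  Finset.univ.filter fun i => m i ≠ 0 ∧ Nat.log 2 (m i) = s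

lemma sum_card_dyadicLevel_le {n : ℕ} (m : Fin n → ℕ) (S : ℕ) :
    ∑ s ∈ Finset.range S, (4 : ℝ) ^ s * (dyadicLevel m s).card ≤ ∑ i, (m i : ℝ) ^ 2 := by
  calc ∑ s ∈ Finset.range S, (4 : ℝ) ^ s * (dyadicLevel m s).card
      = ∑ s ∈ Finset.range S, ∑ i, if i ∈ dyadicLevel m s then (4 : ℝ) ^ s else 0 := by
        refine Finset.sum_congr rfl fun s _ => ?_
        rw [Finset.sum_ite_mem, Finset.univ_inter, Finset.sum_const, nsmul_eq_mul, mul_comm]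
    _ = ∑ i, ∑ s ∈ Finset.range S, if i ∈ dyadicLevel m s then (4 : ℝ) ^ s else 0 :=
        Finset.sum_comm
    _ ≤ ∑ i, (m i : ℝ) ^ 2 := by
        refine Finset.sum_le_sum fun i _ => ?_
        by_cases h0 : m i = 0
        · simp [dyadicLevel, h0]
        have h1 : ∀ s, (i ∈ dyadicLevel m s ↔ s = Nat.log 2 (m i)) := by
          intro s; simp [dyadicLevel, h0, eq_comm]
        simp only [h1, Finset.sum_ite_eq']
        have h2 : (2 : ℝ) ^ Nat.log 2 (m i) ≤ m i := by
          exact_mod_cast Nat.pow_log_le_self 2 h0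
        split_ifs
        · calc (4 : ℝ) ^ Nat.log 2 (m i) = (2 ^ Nat.log 2 (m i)) ^ 2 := by
                rw [← pow_mul, mul_comm, pow_mul]; norm_num
            _ ≤ _ := by gcongr
        · positivity

lemma log_lt_of_sum_sq_le {n : ℕ} {m : Fin n → ℕ} (hm : ∑ i, (m i : ℝ) ^ 2 ≤ 16 * n)
    {i : Fin n} (hi : m i ≠ 0) : Nat.log 2 (m i) < 8 * n := by
  by_contra hcon
  have h1 : (m i : ℝ) ^ 2 ≤ 16 * n :=
    (Finset.single_le_sum (f := fun i => (m i : ℝ) ^ 2) (fun _ _ => sq_nonneg _)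
      (Finset.mem_univ i)).trans hm
  have h2 : m i ^ 2 ≤ 16 * n := by exact_mod_cast h1
  have h3 : 2 ^ (8 * n) ≤ m i :=
    (Nat.pow_le_pow_right two_pos (not_lt.1 hcon)).trans (Nat.pow_log_le_self 2 hi)
  have h4 : (2 ^ (8 * n)) ^ 2 ≤ 16 * n := (Nat.pow_le_pow_left h3 2).trans h2
  rw [← pow_mul] at h4
  have h5 : 8 * n * 2 < 2 ^ (8 * n * 2) := Nat.lt_two_pow_self
  omega

/-- The level pairs for which the discrepancy property is needed: the heavy ones for which
neither vector dominates the other by the factor `2^L`. -/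
def balancedPairs (n L : ℕ) : Finset (ℕ × ℕ) :=
  (Finset.range (8 * n) ×ˢ Finset.range (8 * n)).filter
    fun q => q.1 < q.2 + L ∧ q.2 < q.1 + L ∧ L + 3 ≤ q.1 + q.2

/-- For a fixed level `t`, the weights of the entropy terms over all balanced `(s, t)` form a
series `∑ 2^j / j`, `j = s + t - L < 2 t`, dominated by its last term. -/
lemma sum_balancedPairs_le {n L : ℕ} {b : ℕ → ℕ} (hb : ∀ t, b t ≤ n)
    (hsum : ∑ t ∈ Finset.range (8 * n), (4 : ℝ) ^ t * b t ≤ 16 * n) :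
    ∑ q ∈ balancedPairs n L, 2 ^ (q.1 + q.2) / ((q.1 + q.2 - L : ℕ) : ℝ) *
      subsetEntropy n (b q.2) ≤ 150 * n * 2 ^ L := by
  have h1 : ∀ t, ∑ s ∈ Finset.range (8 * n),
      (if s < t + L ∧ t < s + L ∧ L + 3 ≤ s + t then
        2 ^ (s + t) / ((s + t - L : ℕ) : ℝ) else 0) ≤ 2 ^ L * (3 / 2 * (4 ^ t / t)) := by
    intro t
    rw [← Finset.sum_filter]
    rcases Nat.eq_zero_or_pos t with rfl | ht
    · rw [Finset.filter_false_of_mem (fun s _ => by omega)]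
      simp
    calc _ = ∑ j ∈ (Finset.filter (fun s => s < t + L ∧ t < s + L ∧ L + 3 ≤ s + t)
            (Finset.range (8 * n))).image (fun s => s + t - L), 2 ^ L * ((2 : ℝ) ^ j / j) := by
          rw [Finset.sum_image]
          · refine Finset.sum_congr rfl fun s hs => ?_
            have hs' := (Finset.mem_filter.1 hs).2
            rw [← mul_div_assoc, ← pow_add]
            congr 2
            omega
          · intro s hs s' hs' h
            have h3 := (Finset.mem_filter.1 (Finset.mem_coe.1 hs)).2
            have h4 := (Finset.mem_filter.1 (Finset.mem_coe.1 hs')).2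
            simp only at h
            omega
      _ ≤ ∑ j ∈ Finset.Ico 1 (2 * t), 2 ^ L * ((2 : ℝ) ^ j / j) := by
          refine Finset.sum_le_sum_of_subset_of_nonneg (fun j hj => ?_)
            fun _ _ _ => by positivity
          obtain ⟨s, hs, rfl⟩ := Finset.mem_image.1 hj
          have hs' := (Finset.mem_filter.1 hs).2
          rw [Finset.mem_Ico]
          omega
      _ ≤ 2 ^ L * (3 * 2 ^ (2 * t) / (2 * t : ℕ)) := by
          rw [← Finset.mul_sum]
          gcongr
          exact sum_two_pow_div_le (by omega)
      _ = _ := by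
          rw [pow_mul]; push_cast; norm_num; ring
  have h2 : ∀ t ∈ Finset.range (8 * n), 4 ^ t / (t : ℝ) * subsetEntropy n (b t) ≤
      6 * (4 ^ t * b t) + 2 * n * (1 / 2) ^ t := by
    intro t _
    rcases Nat.eq_zero_or_pos t with rfl | ht
    · simp; positivity
    · exact four_pow_div_mul_subsetEntropy_le ht (hb t)
  have hgeo : ∑ t ∈ Finset.range (8 * n), (1 / 2 : ℝ) ^ t ≤ 2 := sum_geometric_two_le _
  have hn : (0 : ℝ) ≤ n := Nat.cast_nonneg n
  rw [balancedPairs, Finset.sum_filter, Finset.sum_product_right]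
  calc _ = ∑ t ∈ Finset.range (8 * n), (∑ s ∈ Finset.range (8 * n),
      (if s < t + L ∧ t < s + L ∧ L + 3 ≤ s + t then
        2 ^ (s + t) / ((s + t - L : ℕ) : ℝ) else 0)) * subsetEntropy n (b t) := by
        refine Finset.sum_congr rfl fun t _ => ?_
        rw [Finset.sum_mul]
        refine Finset.sum_congr rfl fun s _ => ?_
        rw [ite_mul, zero_mul]
    _ ≤ ∑ t ∈ Finset.range (8 * n), 2 ^ L * (3 / 2 * (4 ^ t / t)) * subsetEntropy n (b t) := by
        refine Finset.sum_le_sum fun t _ => ?_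
        exact mul_le_mul_of_nonneg_right (h1 t) (subsetEntropy_nonneg (hb t))
    _ ≤ ∑ t ∈ Finset.range (8 * n), (2 : ℝ) ^ L * (3 / 2) *
          (6 * (4 ^ t * b t) + 2 * n * (1 / 2 : ℝ) ^ t) := by
        refine Finset.sum_le_sum fun t ht => ?_
        have := mul_le_mul_of_nonneg_left (h2 t ht) (by positivity : (0 : ℝ) ≤ 2 ^ L * (3 / 2))
        linarith
    _ = 2 ^ L * (3 / 2) * (6 * (∑ t ∈ Finset.range (8 * n), (4 : ℝ) ^ t * b t) +
          2 * n * ∑ t ∈ Finset.range (8 * n), (1 / 2 : ℝ) ^ t) := by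
        rw [← Finset.mul_sum, Finset.sum_add_distrib, ← Finset.mul_sum, ← Finset.mul_sum]
    _ ≤ 2 ^ L * (3 / 2) * (6 * (16 * n) + 2 * n * 2) := by gcongr
    _ = _ := by ring

lemma DiscrepancyBound.two_pow_mul_le {n L : ℕ} {A : Matrix (Fin n) (Fin n) ℝ}
    (hA : DiscrepancyBound L A) (I J : Finset (Fin n)) {q : ℕ × ℕ}
    (hq : q ∈ balancedPairs n L) :
    2 ^ (q.1 + q.2) * ∑ a ∈ I, ∑ b ∈ J, A a b ≤
      2 ^ L / n * ((4 ^ q.1 * I.card) * (4 ^ q.2 * J.card)) +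
      16 * (2 ^ (q.1 + q.2) / ((q.1 + q.2 - L : ℕ) : ℝ) *
        (subsetEntropy n I.card + subsetEntropy n J.card)) := by
  obtain ⟨s, t⟩ := q
  simp only [balancedPairs, Finset.mem_filter, Finset.mem_product, Finset.mem_range] at hq ⊢
  obtain ⟨⟨hs, ht⟩, h1, h2, h3⟩ := hq
  obtain ⟨j, hj⟩ : ∃ j, s + t = L + j := ⟨s + t - L, by omega⟩
  have hj3 : 3 ≤ j := by omega
  have hsub : s + t - L = j := by omega
  have hd := hA I J j (Finset.mem_range.2 (by omega))
  rw [hsub]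
  set e := ∑ a ∈ I, ∑ b ∈ J, A a b
  set H := subsetEntropy n I.card + subsetEntropy n J.card
  have hH : 0 ≤ H := add_nonneg (subsetEntropy_nonneg (by simpa using I.card_le_univ))
    (subsetEntropy_nonneg (by simpa using J.card_le_univ))
  have hj' : (3 : ℝ) ≤ j := by exact_mod_cast hj3
  have h4 : (4 : ℝ) ^ s * 4 ^ t = 2 ^ (s + t) * (2 ^ L * 2 ^ j) := by
    rw [← pow_add, ← pow_add, ← hj, show (4 : ℝ) = 2 * 2 by norm_num, mul_pow]
  have h4L : (4 : ℝ) ^ L = 2 ^ L * 2 ^ L := by rw [← mul_pow]; norm_num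
  have ha : (0 : ℝ) ≤ I.card := Nat.cast_nonneg _
  have hb : (0 : ℝ) ≤ J.card := Nat.cast_nonneg _
  generalize (I.card : ℝ) = a at *
  generalize (J.card : ℝ) = b at *
  rcases le_or_gt e 0 with he | he
  · exact (mul_nonpos_of_nonneg_of_nonpos (by positivity) he).trans (by positivity)
  have hlog : (1 / 2 : ℝ) ≤ Real.log 2 := by linarith [Real.log_two_gt_d9]
  have h5 : (j / 4 : ℝ) * e ≤ 1 / 2 * (a * b * (4 ^ L / n) * 2 ^ j) + 4 * H := by
    refine le_trans ?_ hd
    nlinarith [mul_le_mul_of_nonneg_right hlog (by positivity : (0 : ℝ) ≤ j * e)]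
  have h6 : e ≤ (a * b * (4 ^ L / n) * 2 ^ j) + 16 * (H / j) := by
    have h7 : e ≤ 2 / j * (a * b * (4 ^ L / n) * 2 ^ j) + 16 * (H / j) := by
      have h8 := mul_le_mul_of_nonneg_left h5 (by positivity : (0 : ℝ) ≤ 4 / j)
      have h9 : (4 / j : ℝ) * (j / 4 * e) = e := by field_simp
      rw [h9] at h8
      refine h8.trans (le_of_eq ?_)
      field_simp
      ring
    refine h7.trans (add_le_add_left ?_ _)
    refine mul_le_of_le_one_left (by positivity) ?_
    rw [div_le_one (by positivity)]
    linarith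
  calc (2 : ℝ) ^ (s + t) * e ≤ 2 ^ (s + t) *
        ((a * b * (4 ^ L / n) * 2 ^ j) + 16 * (H / j)) := by gcongr
    _ = 2 ^ L / n * ((2 ^ (s + t) * (2 ^ L * 2 ^ j)) * (a * b)) +
        16 * (2 ^ (s + t) / j * H) := by rw [h4L]; ring
    _ = _ := by rw [← h4]; ring

lemma sum_balancedPairs_mul_le {n L : ℕ} {A : Matrix (Fin n) (Fin n) ℝ}
    (hA : DiscrepancyBound L A) {m m' : Fin n → ℕ} (hm : ∑ i, (m i : ℝ) ^ 2 ≤ 16 * n)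
    (hm' : ∑ i, (m' i : ℝ) ^ 2 ≤ 16 * n) :
    ∑ q ∈ balancedPairs n L, 2 ^ (q.1 + q.2) *
      ∑ a ∈ dyadicLevel m q.1, ∑ b ∈ dyadicLevel m' q.2, A a b ≤ 5056 * n * 2 ^ L := by
  have hcard (I : Finset (Fin n)) : I.card ≤ n := by simpa using I.card_le_univ
  have hs := (sum_card_dyadicLevel_le m (8 * n)).trans hm
  have ht := (sum_card_dyadicLevel_le m' (8 * n)).trans hm'
  have e1 := sum_balancedPairs_le (L := L) (fun t => hcard (dyadicLevel m t)) hs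
  have e2 := sum_balancedPairs_le (L := L) (fun t => hcard (dyadicLevel m' t)) ht
  have e3 : ∑ q ∈ balancedPairs n L, 2 ^ (q.1 + q.2) / ((q.1 + q.2 - L : ℕ) : ℝ) *
      subsetEntropy n (dyadicLevel m q.1).card =
      ∑ q ∈ balancedPairs n L, 2 ^ (q.1 + q.2) / ((q.1 + q.2 - L : ℕ) : ℝ) *
      subsetEntropy n (dyadicLevel m q.2).card := by
    refine Finset.sum_equiv (Equiv.prodComm ℕ ℕ) (fun q => ?_) fun q _ => ?_
    · simp only [balancedPairs, Finset.mem_filter, Finset.mem_product, Finset.mem_range,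
        Equiv.prodComm_apply,
        Prod.fst_swap, Prod.snd_swap]
      omega
    · simp only [Equiv.prodComm_apply, Prod.fst_swap, Prod.snd_swap, add_comm q.2 q.1]
  have e4 : ∑ q ∈ balancedPairs n L, (4 ^ q.1 * ((dyadicLevel m q.1).card : ℝ)) *
      (4 ^ q.2 * (dyadicLevel m' q.2).card) ≤ 16 * n * (16 * n) := by
    calc _ ≤ ∑ q ∈ Finset.range (8 * n) ×ˢ Finset.range (8 * n),
          (4 ^ q.1 * ((dyadicLevel m q.1).card : ℝ)) * (4 ^ q.2 * (dyadicLevel m' q.2).card) :=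
          Finset.sum_le_sum_of_subset_of_nonneg (Finset.filter_subset _ _)
            fun _ _ _ => by positivity
      _ = (∑ s ∈ Finset.range (8 * n), (4 : ℝ) ^ s * (dyadicLevel m s).card) *
          ∑ t ∈ Finset.range (8 * n), (4 : ℝ) ^ t * (dyadicLevel m' t).card := by
          rw [Finset.sum_product, Finset.sum_mul_sum]
      _ ≤ _ := by gcongr
  rcases Nat.eq_zero_or_pos n with rfl | hn
  · simp [balancedPairs]
  have hn' : (0 : ℝ) < n := by exact_mod_cast hn
  calc _ ≤ ∑ q ∈ balancedPairs n L, (2 ^ L / n * ((4 ^ q.1 * ((dyadicLevel m q.1).card : ℝ)) *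
          (4 ^ q.2 * (dyadicLevel m' q.2).card)) +
          (16 * (2 ^ (q.1 + q.2) / ((q.1 + q.2 - L : ℕ) : ℝ) *
            subsetEntropy n (dyadicLevel m q.1).card) +
          16 * (2 ^ (q.1 + q.2) / ((q.1 + q.2 - L : ℕ) : ℝ) *
            subsetEntropy n (dyadicLevel m' q.2).card))) :=
        Finset.sum_le_sum fun q hq =>
          (hA.two_pow_mul_le _ _ hq).trans (le_of_eq (by ring))
    _ ≤ 2 ^ L / n * (16 * n * (16 * n)) + (16 * (150 * n * 2 ^ L) + 16 * (150 * n * 2 ^ L)) := by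
        rw [Finset.sum_add_distrib, Finset.sum_add_distrib, ← Finset.mul_sum, ← Finset.mul_sum,
          ← Finset.mul_sum, e3]
        gcongr
    _ = _ := by field_simp; norm_num

/-- Dyadic decomposition of the balanced heavy pairs. -/
lemma sum_balanced_le_sum_blocks {n L : ℕ} {W : Matrix (Fin n) (Fin n) ℝ}
    (hW0 : ∀ i j, 0 ≤ W i j) (m m' : Fin n → ℕ) :
    ∑ i, ∑ j, (if (m i ≠ 0 ∧ m' j ≠ 0) ∧ (Nat.log 2 (m i), Nat.log 2 (m' j)) ∈ balancedPairs n L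
      then 2 ^ (Nat.log 2 (m i) + Nat.log 2 (m' j)) * W i j else 0) ≤
    ∑ q ∈ balancedPairs n L, 2 ^ (q.1 + q.2) *
      ∑ a ∈ dyadicLevel m q.1, ∑ b ∈ dyadicLevel m' q.2, W a b := by
  have h1 : ∀ q : ℕ × ℕ, 2 ^ (q.1 + q.2) *
      ∑ a ∈ dyadicLevel m q.1, ∑ b ∈ dyadicLevel m' q.2, W a b =
      ∑ i, ∑ j, if i ∈ dyadicLevel m q.1 ∧ j ∈ dyadicLevel m' q.2 then
        2 ^ (q.1 + q.2) * W i j else 0 := by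
    intro q
    simp only [ite_and]
    simp [Finset.mul_sum]
  simp only [h1]
  rw [Finset.sum_comm (s := balancedPairs n L)]
  refine Finset.sum_le_sum fun i _ => ?_
  rw [Finset.sum_comm (s := balancedPairs n L)]
  refine Finset.sum_le_sum fun j _ => ?_
  split_ifs with h
  · obtain ⟨⟨hi, hj⟩, hq⟩ := h
    refine le_trans (le_of_eq ?_) (Finset.single_le_sum (fun q _ => ?_) hq)
    · simp [dyadicLevel, hi, hj]
    · split_ifs
      · exact mul_nonneg (by positivity) (hW0 i j)
      · exact le_rfl
  · refine Finset.sum_nonneg fun q _ => ?_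
    split_ifs
    · exact mul_nonneg (by positivity) (hW0 i j)
    · exact le_rfl

/-- The contribution of the heavy pairs is of the order of the light one. Where one vector
dominates the other by the factor `2^L`, the degree bound `τ` suffices; the remaining pairs are
treated by dyadic blocks with the discrepancy property, the parameter being the excess
`j = s + t - L` of the block `(s, t)` over the threshold. -/
theorem DiscrepancyBound.sum_heavy_le {n L : ℕ} {W A : Matrix (Fin n) (Fin n) ℝ} {τ : ℝ}
    (hA : DiscrepancyBound L A) (hW0 : ∀ i j, 0 ≤ W i j) (hWA : ∀ i j, W i j ≤ A i j)
    (hrow : ∀ i, ∑ j, W i j ≤ τ) (hcol : ∀ j, ∑ i, W i j ≤ τ) {m m' : Fin n → ℕ}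
    (hm : ∑ i, (m i : ℝ) ^ 2 ≤ 16 * n) (hm' : ∑ i, (m' i : ℝ) ^ 2 ≤ 16 * n) :
    ∑ i, ∑ j, (if (16 : ℝ) * 2 ^ L < m i * m' j then (m i * m' j : ℝ) else 0) * W i j ≤
      20224 * n * 2 ^ L + 64 * n * (τ / 2 ^ L) := by
  have hpt : ∀ i j, (if (16 : ℝ) * 2 ^ L < m i * m' j then (m i * m' j : ℝ) else 0) * W i j ≤
      2 / 2 ^ L * ((m i : ℝ) ^ 2 * W i j) + 2 / 2 ^ L * ((m' j : ℝ) ^ 2 * W i j) +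
      4 * (if (m i ≠ 0 ∧ m' j ≠ 0) ∧
        (Nat.log 2 (m i), Nat.log 2 (m' j)) ∈ balancedPairs n L
        then 2 ^ (Nat.log 2 (m i) + Nat.log 2 (m' j)) * W i j else 0) := by
    intro i j
    have hW := hW0 i j
    have t1 : 0 ≤ 2 / 2 ^ L * ((m i : ℝ) ^ 2 * W i j) := by positivity
    have t2 : 0 ≤ 2 / 2 ^ L * ((m' j : ℝ) ^ 2 * W i j) := by positivity
    have t3 : 0 ≤ 4 * (if (m i ≠ 0 ∧ m' j ≠ 0) ∧
        (Nat.log 2 (m i), Nat.log 2 (m' j)) ∈ balancedPairs n L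
        then 2 ^ (Nat.log 2 (m i) + Nat.log 2 (m' j)) * W i j else 0) := by
      split_ifs <;> positivity
    split_ifs at t3 ⊢ with hheavy hq hq
    · -- a pair in a balanced block is bounded by the weight of its block
      have hi : (m i : ℝ) ≤ 2 * 2 ^ Nat.log 2 (m i) := by
        have := (Nat.lt_pow_succ_log_self one_lt_two (m i)).le
        rw [pow_succ, mul_comm] at this
        exact_mod_cast this
      have hj : (m' j : ℝ) ≤ 2 * 2 ^ Nat.log 2 (m' j) := by
        have := (Nat.lt_pow_succ_log_self one_lt_two (m' j)).le
        rw [pow_succ, mul_comm] at this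
        exact_mod_cast this
      have : (m i * m' j : ℝ) * W i j ≤
          4 * (2 ^ (Nat.log 2 (m i) + Nat.log 2 (m' j)) * W i j) := by
        calc (m i * m' j : ℝ) * W i j
            ≤ ((2 * 2 ^ Nat.log 2 (m i)) * (2 * 2 ^ Nat.log 2 (m' j))) * W i j := by gcongr
          _ = _ := by rw [pow_add]; ring
      linarith
    · have hpos : (0 : ℝ) < m i * m' j := lt_trans (by positivity) hheavy
      have hi0 : m i ≠ 0 := by rintro h; simp [h] at hpos
      have hj0 : m' j ≠ 0 := by rintro h; simp [h] at hpos
      have hcase : m' j * 2 ^ L ≤ 2 * m i ∨ m i * 2 ^ L ≤ 2 * m' j := by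
        by_contra hcon
        push Not at hcon
        apply hq
        refine ⟨⟨hi0, hj0⟩, ?_⟩
        set s := Nat.log 2 (m i) with hs
        set t := Nat.log 2 (m' j) with ht
        have hsl : 2 ^ s ≤ m i := Nat.pow_log_le_self 2 hi0
        have htl : 2 ^ t ≤ m' j := Nat.pow_log_le_self 2 hj0
        have hsu : m i < 2 ^ (s + 1) := Nat.lt_pow_succ_log_self one_lt_two _
        have htu : m' j < 2 ^ (t + 1) := Nat.lt_pow_succ_log_self one_lt_two _
        have c1 : s + 1 < t + 1 + L := by
          apply (Nat.pow_lt_pow_iff_right one_lt_two).1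
          calc 2 ^ (s + 1) = 2 * 2 ^ s := by ring
            _ ≤ 2 * m i := by omega
            _ < m' j * 2 ^ L := hcon.1
            _ ≤ 2 ^ (t + 1) * 2 ^ L := Nat.mul_le_mul_right _ htu.le
            _ = _ := (pow_add _ _ _).symm
        have c2 : t + 1 < s + 1 + L := by
          apply (Nat.pow_lt_pow_iff_right one_lt_two).1
          calc 2 ^ (t + 1) = 2 * 2 ^ t := by ring
            _ ≤ 2 * m' j := by omega
            _ < m i * 2 ^ L := hcon.2
            _ ≤ 2 ^ (s + 1) * 2 ^ L := Nat.mul_le_mul_right _ hsu.le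
            _ = _ := (pow_add _ _ _).symm
        have c3 : L + 4 < (s + 1) + (t + 1) := by
          apply (Nat.pow_lt_pow_iff_right one_lt_two).1
          have hh : 16 * 2 ^ L < m i * m' j := by exact_mod_cast hheavy
          calc 2 ^ (L + 4) = 16 * 2 ^ L := by rw [pow_add]; ring
            _ < m i * m' j := hh
            _ ≤ 2 ^ (s + 1) * 2 ^ (t + 1) := Nat.mul_le_mul hsu.le htu.le
            _ = _ := (pow_add _ _ _).symm
        simp only [balancedPairs, Finset.mem_filter, Finset.mem_product, Finset.mem_range]
        exact ⟨⟨log_lt_of_sum_sq_le hm hi0, log_lt_of_sum_sq_le hm' hj0⟩, by omega, by omega,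
          by omega⟩
      rcases hcase with h | h
      · have h' : (m' j : ℝ) ≤ 2 * m i / 2 ^ L := by
          rw [le_div_iff₀ (by positivity)]; exact_mod_cast h
        have : (m i * m' j : ℝ) * W i j ≤ 2 / 2 ^ L * ((m i : ℝ) ^ 2 * W i j) := by
          calc (m i * m' j : ℝ) * W i j ≤ (m i * (2 * m i / 2 ^ L)) * W i j := by gcongr
            _ = _ := by ring
        linarith
      · have h' : (m i : ℝ) ≤ 2 * m' j / 2 ^ L := by
          rw [le_div_iff₀ (by positivity)]; exact_mod_cast h
        have : (m i * m' j : ℝ) * W i j ≤ 2 / 2 ^ L * ((m' j : ℝ) ^ 2 * W i j) := by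
          calc (m i * m' j : ℝ) * W i j ≤ ((2 * m' j / 2 ^ L) * m' j) * W i j := by gcongr
            _ = _ := by ring
        linarith
    · linarith
    · linarith
  have hτ : ∀ i : Fin n, 0 ≤ τ := fun i => (Finset.sum_nonneg fun j _ => hW0 i j).trans (hrow i)
  have b1 : ∑ i, ∑ j, (m i : ℝ) ^ 2 * W i j ≤ 16 * n * τ := by
    calc _ ≤ ∑ i, (m i : ℝ) ^ 2 * τ := by
          refine Finset.sum_le_sum fun i _ => ?_
          rw [← Finset.mul_sum]
          gcongr
          exact hrow i
      _ ≤ _ := by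
          rw [← Finset.sum_mul]
          rcases Nat.eq_zero_or_pos n with rfl | hn
          · simp
          · exact mul_le_mul_of_nonneg_right hm (hτ ⟨0, hn⟩)
  have b2 : ∑ i, ∑ j, (m' j : ℝ) ^ 2 * W i j ≤ 16 * n * τ := by
    rw [Finset.sum_comm]
    calc _ ≤ ∑ j, (m' j : ℝ) ^ 2 * τ := by
          refine Finset.sum_le_sum fun i _ => ?_
          rw [← Finset.mul_sum]
          gcongr
          exact hcol i
      _ ≤ _ := by
          rw [← Finset.sum_mul]
          rcases Nat.eq_zero_or_pos n with rfl | hn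
          · simp
          · exact mul_le_mul_of_nonneg_right hm' (hτ ⟨0, hn⟩)
  have b3 := (sum_balanced_le_sum_blocks (L := L) hW0 m m').trans
    ((Finset.sum_le_sum fun q _ => mul_le_mul_of_nonneg_left
      (Finset.sum_le_sum fun a _ => Finset.sum_le_sum fun b _ => hWA a b)
      (by positivity)).trans (sum_balancedPairs_mul_le hA hm hm'))
  refine (Finset.sum_le_sum fun i _ => Finset.sum_le_sum fun j _ => hpt i j).trans ?_
  simp only [Finset.sum_add_distrib, ← Finset.mul_sum]
  have p : (0 : ℝ) ≤ 2 / 2 ^ L := by positivity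
  have b1' := mul_le_mul_of_nonneg_left b1 p
  have b2' := mul_le_mul_of_nonneg_left b2 p
  simp only [← Finset.mul_sum] at b1'
  calc _ ≤ 2 / 2 ^ L * (16 * n * τ) + 2 / 2 ^ L * (16 * n * τ) + 4 * (5056 * n * 2 ^ L) := by
        gcongr
    _ = _ := by ring

/-! ### From the lattice to the operator norm -/

/-- `M` has operator norm at most `K` for the Euclidean norm, in bilinear form. -/
def OpBound {n : ℕ} (M : Matrix (Fin n) (Fin n) ℝ) (K : ℝ) : Prop :=
  ∀ x y : Fin n → ℝ, ∑ i, ∑ j, x i * M i j * y j ≤ K * (√(∑ i, x i ^ 2) * √(∑ i, y i ^ 2))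

lemma OpBound.add {n : ℕ} {M N : Matrix (Fin n) (Fin n) ℝ} {K K' : ℝ} (hM : OpBound M K)
    (hN : OpBound N K') : OpBound (M + N) (K + K') := by
  intro x y
  have h : ∑ i, ∑ j, x i * (M + N) i j * y j =
      ∑ i, ∑ j, x i * M i j * y j + ∑ i, ∑ j, x i * N i j * y j := by
    simp only [← Finset.sum_add_distrib]
    refine Finset.sum_congr rfl fun i _ => Finset.sum_congr rfl fun j _ => ?_
    rw [Matrix.add_apply]; ring
  rw [h, add_mul]
  exact add_le_add (hM x y) (hN x y)

lemma OpBound.mono {n : ℕ} {M : Matrix (Fin n) (Fin n) ℝ} {K K' : ℝ} (hM : OpBound M K)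
    (h : K ≤ K') : OpBound M K' := fun x y =>
  (hM x y).trans (mul_le_mul_of_nonneg_right h (by positivity))

lemma opBound_diagonal {n : ℕ} {d : Fin n → ℝ} {K : ℝ} (hd : ∀ i, |d i| ≤ K) :
    OpBound (Matrix.diagonal d) K := by
  intro x y
  have h : ∑ i, ∑ j, x i * Matrix.diagonal d i j * y j = ∑ i, d i * (x i * y i) := by
    refine Finset.sum_congr rfl fun i _ => ?_
    rw [Finset.sum_eq_single i]
    · rw [Matrix.diagonal_apply_eq]; ring
    · intro j _ hj
      rw [Matrix.diagonal_apply_ne _ hj.symm]; ring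
    · simp
  rw [h]
  rcases isEmpty_or_nonempty (Fin n) with hn | ⟨⟨i₀⟩⟩
  · simp
  have hK : 0 ≤ K := (abs_nonneg _).trans (hd i₀)
  calc ∑ i, d i * (x i * y i) ≤ ∑ i, K * (|x i| * |y i|) := by
        refine Finset.sum_le_sum fun i _ => (le_abs_self _).trans ?_
        rw [abs_mul, abs_mul]
        exact mul_le_mul_of_nonneg_right (hd i) (by positivity)
    _ ≤ _ := by
        rw [← Finset.mul_sum]
        refine mul_le_mul_of_nonneg_left ?_ hK
        simpa only [sq_abs] using
          Real.sum_mul_le_sqrt_mul_sqrt Finset.univ (fun i => |x i|) (fun i => |y i|)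

lemma exists_int_sq_le (a : ℝ) : ∃ m : ℤ, (m : ℝ) ^ 2 ≤ a ^ 2 ∧ (a - m) ^ 2 ≤ 1 := by
  rcases le_total 0 a with h | h
  · refine ⟨⌊a⌋, ?_, ?_⟩
    · have h1 : (0 : ℝ) ≤ ⌊a⌋ := by exact_mod_cast Int.floor_nonneg.2 h
      exact pow_le_pow_left₀ h1 (Int.floor_le a) 2
    · have := Int.floor_le a
      have := Int.lt_floor_add_one a
      nlinarith
  · refine ⟨⌈a⌉, ?_, ?_⟩
    · have h1 : ((⌈a⌉ : ℤ) : ℝ) ≤ 0 := by exact_mod_cast Int.ceil_le.2 (by simpa using h)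
      have := Int.le_ceil a
      nlinarith
    · have := Int.le_ceil a
      have := Int.ceil_lt_add_one a
      nlinarith

/-- The `1/4`-net argument: rounding `4 √n x` towards zero gives a lattice vector, and the
maximum `V` of the bilinear form on the unit balls satisfies `V ≤ K + V / 4 + V / 4`. -/
theorem opBound_of_latticeBall {n : ℕ} {M : Matrix (Fin n) (Fin n) ℝ} {K : ℝ}
    (h : ∀ m ∈ latticeBall n, ∀ m' ∈ latticeBall n,
      ∑ i, ∑ j, (m i : ℝ) * M i j * m' j ≤ 16 * n * K) : OpBound M (2 * K) := by
  rcases Nat.eq_zero_or_pos n with rfl | hn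
  · intro x y; simp
  have hn' : (0 : ℝ) < n := by exact_mod_cast hn
  set F : (Fin n → ℝ) → (Fin n → ℝ) → ℝ := fun x y => ∑ i, ∑ j, x i * M i j * y j with hF
  have Fadd1 (x x' y) : F (x + x') y = F x y + F x' y := by
    simp only [hF, ← Finset.sum_add_distrib, Pi.add_apply, add_mul]
  have Fadd2 (x y y') : F x (y + y') = F x y + F x y' := by
    simp only [hF, ← Finset.sum_add_distrib, Pi.add_apply, mul_add]
  have Fsmul1 (c : ℝ) (x y) : F (c • x) y = c * F x y := by
    simp only [hF, Finset.mul_sum, Pi.smul_apply, smul_eq_mul, mul_assoc]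
  have Fsmul2 (c : ℝ) (x y) : F x (c • y) = c * F x y := by
    simp only [hF, Finset.mul_sum, Pi.smul_apply, smul_eq_mul]
    refine Finset.sum_congr rfl fun i _ => Finset.sum_congr rfl fun j _ => ?_
    ring
  set S : Set (Fin n → ℝ) := {x | ∑ i, x i ^ 2 ≤ 1} with hS
  have memS (x : Fin n → ℝ) : x ∈ S ↔ ∑ i, x i ^ 2 ≤ 1 := Iff.rfl
  have hScomp : IsCompact S := by
    refine (isCompact_Icc (a := fun _ : Fin n => (-1 : ℝ)) (b := fun _ => 1)).of_isClosed_subset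
      (isClosed_le (by fun_prop) continuous_const) fun x hx => ?_
    have hx' (i) : x i ^ 2 ≤ 1 :=
      (Finset.single_le_sum (f := fun i => x i ^ 2) (fun _ _ => sq_nonneg _)
        (Finset.mem_univ i)).trans hx
    exact ⟨fun i => (abs_le.1 ((sq_le_one_iff_abs_le_one _).1 (hx' i))).1,
      fun i => (abs_le.1 ((sq_le_one_iff_abs_le_one _).1 (hx' i))).2⟩
  have h0S : (0 : Fin n → ℝ) ∈ S := by rw [memS]; simp
  obtain ⟨⟨xs, ys⟩, hxy, hmax⟩ := (hScomp.prod hScomp).exists_isMaxOn ⟨(0, 0), h0S, h0S⟩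
    (f := fun q : (Fin n → ℝ) × (Fin n → ℝ) => F q.1 q.2) (by
      simp only [hF]
      fun_prop)
  set V := F xs ys with hV
  have hmax' (x y) (hx : x ∈ S) (hy : y ∈ S) : F x y ≤ V := by
    exact hmax (show (x, y) ∈ S ×ˢ S from ⟨hx, hy⟩)
  have hround (x : Fin n → ℝ) (hx : x ∈ S) : ∃ m ∈ latticeBall n, ∃ e ∈ S,
      x = (1 / (4 * √n)) • (fun i => (m i : ℝ)) + (1 / 4 : ℝ) • e ∧
      (1 / (4 * √n)) • (fun i => (m i : ℝ)) ∈ S := by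
    choose m hm1 hm2 using fun i => exists_int_sq_le (4 * √n * x i)
    have hsq : √(n : ℝ) ^ 2 = n := Real.sq_sqrt hn'.le
    have hsn : 0 < √(n : ℝ) := Real.sqrt_pos.2 hn'
    have hmsum : ∑ i, (m i : ℝ) ^ 2 ≤ 16 * n := by
      calc ∑ i, (m i : ℝ) ^ 2 ≤ ∑ i, 16 * n * x i ^ 2 := by
            refine Finset.sum_le_sum fun i _ => (hm1 i).trans (le_of_eq ?_)
            rw [mul_pow, mul_pow, hsq]; norm_num
        _ ≤ 16 * n * 1 := by
            rw [← Finset.mul_sum]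
            gcongr
            exact hx
        _ = _ := by ring
    refine ⟨m, mem_latticeBall.2 (by exact_mod_cast hmsum),
      fun i => (4 * √n * x i - m i) / √n, ?_, ?_, ?_⟩
    · rw [memS]
      calc ∑ i, ((4 * √n * x i - m i) / √n) ^ 2 ≤ ∑ _i : Fin n, 1 / (n : ℝ) := by
            refine Finset.sum_le_sum fun i _ => ?_
            rw [div_pow, hsq]
            gcongr
            exact hm2 i
        _ = 1 := by simp [hn'.ne']
    · funext i
      simp only [Pi.add_apply, Pi.smul_apply, smul_eq_mul]
      field_simp
      ring
    · rw [memS]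
      simp only [Pi.smul_apply, smul_eq_mul, mul_pow, ← Finset.mul_sum, div_pow, hsq, one_pow]
      calc 1 / (4 ^ 2 * (n : ℝ)) * ∑ i, (m i : ℝ) ^ 2 ≤ 1 / (4 ^ 2 * (n : ℝ)) * (16 * n) := by
            gcongr
        _ = 1 := by field_simp; norm_num
  have hVK : V ≤ 2 * K := by
    obtain ⟨m, hm, e, he, hx, hmS⟩ := hround xs hxy.1
    obtain ⟨m', hm', e', he', hy, -⟩ := hround ys hxy.2
    have h1 : F ((1 / (4 * √n)) • (fun i => (m i : ℝ))) ((1 / (4 * √n)) • (fun i => (m' i : ℝ)))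
        ≤ K := by
      rw [Fsmul1, Fsmul2, ← mul_assoc]
      have h2 := h m hm m' hm'
      have h3 : 1 / (4 * √(n : ℝ)) * (1 / (4 * √n)) = 1 / (16 * n) := by
        rw [div_mul_div_comm, one_mul]
        congr 1
        nlinarith [Real.mul_self_sqrt hn'.le]
      rw [h3]
      calc 1 / (16 * (n : ℝ)) * F _ _ ≤ 1 / (16 * (n : ℝ)) * (16 * n * K) :=
            mul_le_mul_of_nonneg_left h2 (by positivity)
        _ = K := by field_simp
    have h4 : V = F ((1 / (4 * √n)) • (fun i => (m i : ℝ)))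
        ((1 / (4 * √n)) • (fun i => (m' i : ℝ))) +
        1 / 4 * F ((1 / (4 * √n)) • (fun i => (m i : ℝ))) e' + 1 / 4 * F e ys := by
      rw [hV]
      conv_lhs => rw [hx]
      rw [Fadd1, Fsmul1 (1 / 4)]
      conv_lhs => rw [hy]
      rw [Fadd2, Fsmul2 (1 / 4), ← hy]
    have h5 := hmax' _ _ hmS he'
    have h6 := hmax' _ _ he hxy.2
    linarith
  intro x y
  have hnorm (x : Fin n → ℝ) : ∃ e ∈ S, x = √(∑ i, x i ^ 2) • e := by
    have hnn : 0 ≤ ∑ i, x i ^ 2 := Finset.sum_nonneg fun i _ => sq_nonneg _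
    rcases hnn.eq_or_lt with h0 | h0
    · refine ⟨0, h0S, ?_⟩
      have := (Finset.sum_eq_zero_iff_of_nonneg fun i _ => sq_nonneg (x i)).1 h0.symm
      funext i
      simpa using this i (Finset.mem_univ i)
    · have hs := Real.sqrt_pos.2 h0
      refine ⟨(√(∑ i, x i ^ 2))⁻¹ • x, ?_, ?_⟩
      · rw [memS]
        simp only [Pi.smul_apply, smul_eq_mul, mul_pow, ← Finset.mul_sum, inv_pow,
          Real.sq_sqrt hnn]
        rw [inv_mul_cancel₀ h0.ne']
      · rw [smul_smul, mul_inv_cancel₀ hs.ne', one_smul]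
  obtain ⟨e, he, hx⟩ := hnorm x
  obtain ⟨e', he', hy⟩ := hnorm y
  have h7 : F x y = √(∑ i, x i ^ 2) * (√(∑ i, y i ^ 2) * F e e') := by
    conv_lhs => rw [hx, hy]
    rw [Fsmul1, Fsmul2]
  show F x y ≤ _
  rw [h7, ← mul_assoc, mul_comm (2 * K)]
  exact mul_le_mul_of_nonneg_left ((hmax' _ _ he he').trans hVK) (by positivity)

/-! ### The trimmed adjacency matrix -/

/-- The nodes whose row survives the trimming. -/
def keptNodes {n : ℕ} (τ : ℝ) (A : Matrix (Fin n) (Fin n) ℝ) : Set (Fin n) :=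
  {i | ∑ l, A i l ≤ τ}

open scoped Classical in
lemma trim_apply {n : ℕ} (τ : ℝ) (A : Matrix (Fin n) (Fin n) ℝ) (i j : Fin n) :
    trim τ A i j = if i ∈ keptNodes τ A ∧ j ∈ keptNodes τ A then A i j else 0 := by
  simp only [trim, Matrix.of_apply, keptNodes, Set.mem_ofPred_eq]
  by_cases h1 : ∑ l, A i l ≤ τ <;> by_cases h2 : ∑ l, A j l ≤ τ <;>
    simp [h1, h2, not_lt.2, not_le.1]

lemma trim_nonneg {n : ℕ} {τ : ℝ} {A : Matrix (Fin n) (Fin n) ℝ} (hA : ∀ i j, 0 ≤ A i j)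
    (i j : Fin n) : 0 ≤ trim τ A i j := by
  classical
  rw [trim_apply]; split_ifs
  exacts [hA i j, le_rfl]

lemma trim_le {n : ℕ} {τ : ℝ} {A : Matrix (Fin n) (Fin n) ℝ} (hA : ∀ i j, 0 ≤ A i j)
    (i j : Fin n) : trim τ A i j ≤ A i j := by
  classical
  rw [trim_apply]; split_ifs
  exacts [le_rfl, hA i j]

lemma sum_trim_le {n : ℕ} {τ : ℝ} (hτ : 0 ≤ τ) {A : Matrix (Fin n) (Fin n) ℝ}
    (hA : ∀ i j, 0 ≤ A i j) (i : Fin n) : ∑ j, trim τ A i j ≤ τ := by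
  classical
  by_cases h : i ∈ keptNodes τ A
  · exact (Finset.sum_le_sum fun j _ => trim_le hA i j).trans h
  · simp only [trim_apply, h, false_and, if_false, Finset.sum_const_zero, hτ]

lemma trim_symm {n : ℕ} {τ : ℝ} {A : Matrix (Fin n) (Fin n) ℝ} (hs : ∀ i j, A i j = A j i)
    (i j : Fin n) : trim τ A i j = trim τ A j i := by
  classical
  rw [trim_apply, trim_apply, hs i j]
  simp only [and_comm]

open scoped Classical in
/-- Few nodes are trimmed: their edges to the whole vertex set violate the discrepancy bound
otherwise. -/
lemma DiscrepancyBound.card_trimmed_le {n L : ℕ} (hn : 0 < n) {A : Matrix (Fin n) (Fin n) ℝ}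
    (hA : DiscrepancyBound L A) {τ : ℝ} (hτ : 4 * 4 ^ L ≤ τ) :
    ((Finset.univ.filter fun i => i ∉ keptNodes τ A).card : ℝ) ≤ 25 * n / 4 ^ L := by
  set I := Finset.univ.filter fun i => i ∉ keptNodes τ A with hI
  have hn' : (0 : ℝ) < n := by exact_mod_cast hn
  have hIcard : I.card ≤ n := by simpa using I.card_le_univ
  -- the smallest parameter `j = 1` suffices, as the threshold exceeds the mean degree fourfold
  have h1 := hA I Finset.univ 1 (Finset.mem_range.2 (by omega))
  have h2 : I.card * τ ≤ ∑ a ∈ I, ∑ b, A a b := by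
    rw [← nsmul_eq_mul]
    refine Finset.card_nsmul_le_sum _ _ _ fun a ha => ?_
    have : a ∉ keptNodes τ A := (Finset.mem_filter.1 ha).2
    exact (not_le.1 this).le
  have h3 := subsetEntropy_le hIcard
  have h4 := subsetEntropy_le (le_refl n)
  rw [Finset.card_univ, Fintype.card_fin] at h1
  have h5 : (I.card : ℝ) * n * (4 ^ L / n) * 2 ^ 1 = 2 * (I.card * 4 ^ L) := by field_simp
  rw [h5] at h1
  have h6 : (I.card : ℝ) * (4 * 4 ^ L) ≤ I.card * τ := by gcongr
  have h7 : (0 : ℝ) ≤ I.card * 4 ^ L := by positivity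
  rw [le_div_iff₀ (by positivity)]
  have hlog := Real.log_two_gt_d9
  have h8 : (0.69 / 2 : ℝ) * (I.card * (4 * 4 ^ L)) ≤
      ((1 : ℕ) / 2 * Real.log 2) * ∑ a ∈ I, ∑ b, A a b := by
    apply mul_le_mul _ (h6.trans h2) (by positivity) (by positivity)
    push_cast
    linarith
  linarith

/-- **Concentration of the trimmed adjacency matrix** on the kept nodes. -/
lemma opBound_restrict_of_bounds {n L : ℕ} {P A : Matrix (Fin n) (Fin n) ℝ}
    (hlight : LightBound L P A) (hdisc : DiscrepancyBound L A) (hA : ∀ i j, 0 ≤ A i j)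
    (hs : ∀ i j, A i j = A j i) (hP : ∀ i j, 0 ≤ P i j) (hPL : ∀ i j, P i j ≤ 4 ^ L / n)
    {τ c : ℝ} (hτ0 : 0 ≤ τ) (hτ : τ ≤ c * 4 ^ L) {M : Matrix (Fin n) (Fin n) ℝ}
    (hM1 : ∀ i ∈ keptNodes τ A, ∀ j ∈ keptNodes τ A, M i j = A i j - P i j)
    (hM0 : ∀ i j, ¬ (i ∈ keptNodes τ A ∧ j ∈ keptNodes τ A) → M i j = 0) :
    OpBound M (2 * ((1345 + 4 * c) * 2 ^ L)) := by
  classical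
  refine opBound_of_latticeBall fun m hm m' hm' => ?_
  set J := keptNodes τ A with hJ
  have h4L : (4 : ℝ) ^ L = 2 ^ L * 2 ^ L := by rw [← mul_pow]; norm_num
  have mask (m : Fin n → ℤ) (hm : m ∈ latticeBall n) :
      (fun i => if i ∈ J then m i else 0) ∈ latticeBall n := by
    rw [mem_latticeBall] at hm ⊢
    refine (Finset.sum_le_sum fun i _ => ?_).trans hm
    split_ifs
    · exact le_rfl
    · simpa using sq_nonneg (m i)
  -- the lattice ball is stable under restriction to the kept nodes
  set r : Fin n → ℤ := fun i => if i ∈ J then m i else 0 with hr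
  set r' : Fin n → ℤ := fun i => if i ∈ J then m' i else 0 with hr'
  have hrm := mask m hm
  have hrm' := mask m' hm'
  have key : ∀ i j, (m i : ℝ) * M i j * m' j ≤
      (if |(r i * r' j : ℝ)| ≤ 16 * 2 ^ L then (r i * r' j : ℝ) else 0) * (A i j - P i j) +
      (if (16 : ℝ) * 2 ^ L < ((r i).natAbs : ℝ) * ((r' j).natAbs : ℝ) then
        (((r i).natAbs : ℝ) * ((r' j).natAbs : ℝ)) else 0) * trim τ A i j +
      1 / (16 * 2 ^ L) * (4 ^ L / n) * ((r i : ℝ) ^ 2 * (r' j : ℝ) ^ 2) := by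
    intro i j
    have habs : ((r i).natAbs : ℝ) * ((r' j).natAbs : ℝ) = |(r i * r' j : ℝ)| := by
      rw [Nat.cast_natAbs, Nat.cast_natAbs, abs_mul]
      push_cast
      rfl
    rw [habs]
    by_cases hij : i ∈ J ∧ j ∈ J
    · have hri : r i = m i := by simp [hr, hij.1]
      have hrj : r' j = m' j := by simp [hr', hij.2]
      rw [hM1 i hij.1 j hij.2, trim_apply, if_pos hij, ← hri, ← hrj]
      have hpos : 0 ≤ 1 / (16 * 2 ^ L) * (4 ^ L / n) * ((r i : ℝ) ^ 2 * (r' j : ℝ) ^ 2) := by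
        positivity
      rcases le_or_gt |(r i * r' j : ℝ)| (16 * 2 ^ L) with h | h
      · rw [if_pos h, if_neg (not_lt.2 h)]
        linarith
      · rw [if_neg (not_le.2 h), if_pos h]
        set v : ℝ := r i * r' j with hv
        have h1 : v * A i j ≤ |v| * A i j := by
          gcongr
          · exact hA i j
          · exact le_abs_self v
        have h2 : -v * P i j ≤
            1 / (16 * 2 ^ L) * (4 ^ L / n) * ((r i : ℝ) ^ 2 * (r' j : ℝ) ^ 2) := by
          have h3 : |v| ≤ 1 / (16 * 2 ^ L) * v ^ 2 := by
            rw [← sq_abs, div_mul_eq_mul_div, one_mul, le_div_iff₀ (by positivity), sq]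
            gcongr
          calc -v * P i j ≤ |v| * P i j := by
                gcongr
                · exact hP i j
                · exact neg_le_abs v
            _ ≤ (1 / (16 * 2 ^ L) * v ^ 2) * (4 ^ L / n) := by
                gcongr
                · exact hP i j
                · exact hPL i j
            _ = _ := by rw [hv]; ring
        calc (r i : ℝ) * (A i j - P i j) * r' j = v * A i j + -v * P i j := by rw [hv]; ring
          _ ≤ _ := by linarith
    · rw [hM0 i j hij]
      have : (r i * r' j : ℝ) = 0 := by
        rw [not_and_or] at hij
        rcases hij with h | h <;> simp [hr, hr', h]
      have h2 : (0 : ℝ) ≤ 16 * 2 ^ L := by positivity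
      rw [this, abs_zero, if_pos h2, if_neg (not_lt.2 h2)]
      simp only [mul_zero, zero_mul, zero_add]
      positivity
  refine (Finset.sum_le_sum fun i _ => Finset.sum_le_sum fun j _ => key i j).trans ?_
  simp only [Finset.sum_add_distrib, ← Finset.mul_sum]
  have b1 := hlight r hrm r' hrm'
  have natsq (m : Fin n → ℤ) (hm : m ∈ latticeBall n) :
      ∑ i, (((m i).natAbs : ℕ) : ℝ) ^ 2 ≤ 16 * n := by
    refine le_trans (le_of_eq ?_) (sum_sq_le_of_mem hm)
    refine Finset.sum_congr rfl fun i _ => ?_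
    rw [Nat.cast_natAbs]
    push_cast
    rw [sq_abs]
  have b2 := hdisc.sum_heavy_le (W := trim τ A) (τ := τ) (trim_nonneg hA) (trim_le hA)
    (sum_trim_le hτ0 hA)
    (fun j => (Finset.sum_congr rfl fun i _ => trim_symm hs i j).le.trans (sum_trim_le hτ0 hA j))
    (natsq r hrm) (natsq r' hrm')
  have b3 : 1 / (16 * 2 ^ L) * (4 ^ L / n) * ∑ i, (r i : ℝ) ^ 2 * ∑ j, (r' j : ℝ) ^ 2 ≤
      16 * n * 2 ^ L := by
    rw [← Finset.sum_mul]
    rcases Nat.eq_zero_or_pos n with rfl | hn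
    · simp
    have hn' : (0 : ℝ) < n := by exact_mod_cast hn
    calc _ ≤ 1 / (16 * 2 ^ L) * (4 ^ L / (n : ℝ)) * ((16 * n) * (16 * n)) := by
          gcongr
          · exact sum_sq_le_of_mem hrm
          · exact sum_sq_le_of_mem hrm'
      _ = _ := by rw [h4L]; field_simp
  have b4 : 64 * n * (τ / 2 ^ L) ≤ 64 * n * (c * 2 ^ L) := by
    gcongr
    rw [div_le_iff₀ (by positivity), mul_assoc, ← h4L]
    exact hτ
  refine (add_le_add (add_le_add b1 (b2.trans (add_le_add_right b4 _))) b3).trans (le_of_eq ?_)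
  ring

/-- Restricting to the entries with a trimmed index costs little, as there are few of them. -/
lemma opBound_of_trimmed_entries {n L : ℕ} {P N : Matrix (Fin n) (Fin n) ℝ} {J : Set (Fin n)}
    [DecidablePred (· ∈ J)] (hP : ∀ i j, 0 ≤ P i j) (hPL : ∀ i j, P i j ≤ 4 ^ L / n)
    (hcard : ((Finset.univ.filter fun i => i ∉ J).card : ℝ) ≤ 25 * n / 4 ^ L)
    (hN0 : ∀ i ∈ J, ∀ j ∈ J, N i j = 0)
    (hN1 : ∀ i j, ¬ (i ∈ J ∧ j ∈ J) → N i j = - P i j) : OpBound N (10 * 2 ^ L) := by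
  intro x y
  rcases Nat.eq_zero_or_pos n with rfl | hn
  · simp
  have hn' : (0 : ℝ) < n := by exact_mod_cast hn
  have h4L : (4 : ℝ) ^ L = 2 ^ L * 2 ^ L := by rw [← mul_pow]; norm_num
  set I := Finset.univ.filter fun i => i ∉ J with hI
  have hsq : √(n : ℝ) * √n = n := Real.mul_self_sqrt hn'.le
  have cs (s : Finset (Fin n)) (x : Fin n → ℝ) :
      ∑ i ∈ s, |x i| ≤ √s.card * √(∑ i, x i ^ 2) := by
    have h1 := Real.sum_mul_le_sqrt_mul_sqrt s (fun _ => 1) (fun i => |x i|)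
    simp only [one_mul, one_pow, Finset.sum_const, nsmul_eq_mul, mul_one, sq_abs] at h1
    refine h1.trans ?_
    gcongr
    exact Finset.subset_univ s
  have hsI : √(I.card : ℝ) ≤ 5 * √n / 2 ^ L := by
    rw [Real.sqrt_le_left (by positivity)]
    refine hcard.trans (le_of_eq ?_)
    rw [div_pow, mul_pow, Real.sq_sqrt hn'.le, h4L]
    ring
  have hsU : √((Finset.univ : Finset (Fin n)).card : ℝ) = √n := by simp
  set X := √(∑ i, x i ^ 2)
  set Y := √(∑ i, y i ^ 2)
  have hX : 0 ≤ X := Real.sqrt_nonneg _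
  have hY : 0 ≤ Y := Real.sqrt_nonneg _
  have key : ∀ i j, x i * N i j * y j ≤
      4 ^ L / n * ((if i ∈ I then |x i| else 0) * |y j|) +
      4 ^ L / n * (|x i| * (if j ∈ I then |y j| else 0)) := by
    intro i j
    by_cases hij : i ∈ J ∧ j ∈ J
    · rw [hN0 i hij.1 j hij.2]
      simp [hI, hij.1, hij.2]
    · rw [hN1 i j hij]
      have h1 : x i * -P i j * y j ≤ 4 ^ L / n * (|x i| * |y j|) := by
        calc x i * -P i j * y j ≤ |x i * -P i j * y j| := le_abs_self _
          _ = P i j * (|x i| * |y j|) := by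
              rw [abs_mul, abs_mul, abs_neg, abs_of_nonneg (hP i j)]; ring
          _ ≤ _ := by gcongr; exact hPL i j
      rw [not_and_or] at hij
      rcases hij with h | h
      · have hi : i ∈ I := by simp [hI, h]
        rw [if_pos hi]
        refine h1.trans (le_add_of_nonneg_right ?_)
        split_ifs <;> positivity
      · have hj : j ∈ I := by simp [hI, h]
        rw [if_pos hj]
        refine h1.trans (le_add_of_nonneg_left ?_)
        split_ifs <;> positivity
  refine (Finset.sum_le_sum fun i _ => Finset.sum_le_sum fun j _ => key i j).trans ?_
  have hind (x : Fin n → ℝ) : ∑ i, (if i ∈ I then |x i| else 0) = ∑ i ∈ I, |x i| := by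
    simp
  simp only [Finset.sum_add_distrib, ← Finset.mul_sum, ← Finset.sum_mul, hind]
  have c1 := cs I x
  have c2 := cs I y
  have c3 := cs Finset.univ x
  have c4 := cs Finset.univ y
  rw [hsU] at c3 c4
  have c1' : ∑ i ∈ I, |x i| ≤ 5 * √n / 2 ^ L * X := c1.trans (by gcongr)
  have c2' : ∑ i ∈ I, |y i| ≤ 5 * √n / 2 ^ L * Y := c2.trans (by gcongr)
  calc _ ≤ 4 ^ L / n * ((5 * √n / 2 ^ L * X) * (√n * Y)) +
        4 ^ L / n * ((√n * X) * (5 * √n / 2 ^ L * Y)) := by gcongr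
    _ = (√n * √n) * (10 * (4 ^ L / n / 2 ^ L * (X * Y))) := by ring
    _ = _ := by rw [hsq, h4L]; field_simp

theorem opBound_trim_sub {n L : ℕ} (hn : 0 < n) {P A : Matrix (Fin n) (Fin n) ℝ}
    (hlight : LightBound L P A) (hdisc : DiscrepancyBound L A) (hA : ∀ i j, 0 ≤ A i j)
    (hs : ∀ i j, A i j = A j i) (hP : ∀ i j, 0 ≤ P i j) (hPL : ∀ i j, P i j ≤ 4 ^ L / n)
    {τ c : ℝ} (hτ1 : 4 * 4 ^ L ≤ τ) (hτ : τ ≤ c * 4 ^ L) :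
    OpBound (trim τ A - P) ((2700 + 8 * c) * 2 ^ L) := by
  classical
  set J := keptNodes τ A with hJ
  set M : Matrix (Fin n) (Fin n) ℝ :=
    Matrix.of fun i j => if i ∈ J ∧ j ∈ J then A i j - P i j else 0 with hM
  set N : Matrix (Fin n) (Fin n) ℝ :=
    Matrix.of fun i j => if i ∈ J ∧ j ∈ J then 0 else - P i j with hN
  have h1 : OpBound M (2 * ((1345 + 4 * c) * 2 ^ L)) := by
    refine opBound_restrict_of_bounds hlight hdisc hA hs hP hPL
      (le_trans (by positivity) hτ1) hτ (fun i hi j hj => ?_) fun i j hij => ?_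
    · simp only [hM, Matrix.of_apply]; rw [if_pos ⟨hi, hj⟩]
    · simp only [hM, Matrix.of_apply]; rw [if_neg hij]
  have h2 : OpBound N (10 * 2 ^ L) := by
    refine opBound_of_trimmed_entries (J := J) hP hPL (hdisc.card_trimmed_le hn hτ1)
      (fun i hi j hj => ?_) fun i j hij => ?_
    · simp only [hN, Matrix.of_apply]; rw [if_pos ⟨hi, hj⟩]
    · simp only [hN, Matrix.of_apply]; rw [if_neg hij]
  have h3 : trim τ A - P = M + N := by
    ext i j
    rw [Matrix.sub_apply, Matrix.add_apply, trim_apply]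
    simp only [hM, hN, Matrix.of_apply]
    split_ifs <;> ring
  rw [h3]
  exact (h1.add h2).mono (le_of_eq (by ring))

/-! ### Low-rank approximation -/

lemma rank_sub_le {n : ℕ} (M N : Matrix (Fin n) (Fin n) ℝ) :
    (M - N).rank ≤ M.rank + N.rank := by
  have h : LinearMap.range (M - N).mulVecLin ≤
      LinearMap.range M.mulVecLin ⊔ LinearMap.range N.mulVecLin := by
    rintro _ ⟨v, rfl⟩
    rw [Matrix.mulVecLin_apply, Matrix.sub_mulVec, sub_eq_add_neg]
    exact Submodule.add_mem_sup ⟨v, rfl⟩ (Submodule.neg_mem _ ⟨v, rfl⟩)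
  exact (Submodule.finrank_mono h).trans (Submodule.finrank_add_le_finrank_add_finrank _ _)

/-- An orthonormal basis of the column space gives a factorization with `rank R` terms. -/
lemma exists_orthonormal_factorization {n : ℕ} (R : Matrix (Fin n) (Fin n) ℝ) :
    ∃ u g : Fin R.rank → Fin n → ℝ, (∀ l, ∑ i, u l i ^ 2 = 1) ∧
      (∀ i j, R i j = ∑ l, u l i * g l j) ∧ ∀ j, ∑ l, g l j ^ 2 = ∑ i, R i j ^ 2 := by
  set S : Submodule ℝ (EuclideanSpace ℝ (Fin n)) :=
    (Submodule.span ℝ (Set.range R.col)).map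
      ((WithLp.linearEquiv 2 ℝ (Fin n → ℝ)).symm :
        (Fin n → ℝ) →ₗ[ℝ] EuclideanSpace ℝ (Fin n)) with hS
  have hd : Module.finrank ℝ S = R.rank := by
    rw [hS, LinearEquiv.finrank_map_eq, Matrix.rank_eq_finrank_span_cols]
  set b := (stdOrthonormalBasis ℝ S).reindex (finCongr hd) with hb
  have hmem (j : Fin n) : (WithLp.toLp 2 (R.col j) : EuclideanSpace ℝ (Fin n)) ∈ S :=
    ⟨R.col j, Submodule.subset_span ⟨j, rfl⟩, rfl⟩
  refine ⟨fun l i => (b l : EuclideanSpace ℝ (Fin n)) i, fun l j => inner ℝ (b l) (⟨_, hmem j⟩ : S),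
    fun l => ?_, fun i j => ?_, fun j => ?_⟩
  · have h1 : ‖(b l : EuclideanSpace ℝ (Fin n))‖ = 1 := b.orthonormal.1 l
    have h2 := EuclideanSpace.real_norm_sq_eq (b l : EuclideanSpace ℝ (Fin n))
    rw [h1] at h2
    simpa using h2.symm
  · have h1 := congrArg (fun s : S => (s : EuclideanSpace ℝ (Fin n)) i)
      (b.sum_repr' (⟨_, hmem j⟩ : S))
    simp only [Submodule.coe_sum, Submodule.coe_smul] at h1
    refine Eq.trans h1.symm ?_
    simp [WithLp.ofLp_sum, Finset.sum_apply, mul_comm]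
  · have h1 := b.sum_sq_inner_right (⟨_, hmem j⟩ : S)
    rw [h1]
    have h2 := EuclideanSpace.real_norm_sq_eq (WithLp.toLp 2 (R.col j) : EuclideanSpace ℝ (Fin n))
    exact h2

lemma frobSq_nonneg {n : ℕ} (M : Matrix (Fin n) (Fin n) ℝ) : 0 ≤ frobSq M :=
  Finset.sum_nonneg fun _ _ => Finset.sum_nonneg fun _ _ => sq_nonneg _

/-- Duality between the operator norm and the nuclear norm, the latter bounded by
`√(rank R) ‖R‖_F`. -/
lemma OpBound.sum_mul_le {n : ℕ} {W R : Matrix (Fin n) (Fin n) ℝ} {K : ℝ} (hW : OpBound W K)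
    (hK : 0 ≤ K) : ∑ i, ∑ j, W i j * R i j ≤ K * (√R.rank * √(frobSq R)) := by
  obtain ⟨u, g, hu, hR, hg⟩ := exists_orthonormal_factorization R
  have h1 : ∑ i, ∑ j, W i j * R i j = ∑ l, ∑ i, ∑ j, u l i * W i j * g l j := by
    rw [Finset.sum_comm (s := (Finset.univ : Finset (Fin R.rank)))]
    refine Finset.sum_congr rfl fun i _ => ?_
    rw [Finset.sum_comm (s := (Finset.univ : Finset (Fin R.rank)))]
    refine Finset.sum_congr rfl fun j _ => ?_
    rw [hR, Finset.mul_sum]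
    refine Finset.sum_congr rfl fun l _ => ?_
    ring
  have h2 : frobSq R = ∑ l, ∑ j, g l j ^ 2 := by
    rw [frobSq, Finset.sum_comm, Finset.sum_comm (s := (Finset.univ : Finset (Fin R.rank)))]
    exact Finset.sum_congr rfl fun j _ => (hg j).symm
  rw [h1]
  calc _ ≤ ∑ l, K * (1 * √(∑ j, g l j ^ 2)) := by
        refine Finset.sum_le_sum fun l _ => (hW (u l) (g l)).trans (le_of_eq ?_)
        rw [hu, Real.sqrt_one]
    _ = K * ∑ l, 1 * √(∑ j, g l j ^ 2) := by rw [Finset.mul_sum]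
    _ ≤ _ := by
        refine mul_le_mul_of_nonneg_left ?_ hK
        refine (Real.sum_mul_le_sqrt_mul_sqrt Finset.univ (fun _ => 1)
          fun l => √(∑ j, g l j ^ 2)).trans (le_of_eq ?_)
        rw [h2]
        congr 2
        · simp
        · exact Finset.sum_congr rfl fun l _ =>
            Real.sq_sqrt (Finset.sum_nonneg fun j _ => sq_nonneg _)

/-- Comparing `Q` with the competitor `R` gives `‖Q - R‖_F² ≤ 2 ⟨T - R, Q - R⟩`, and `Q - R` has
rank at most `2 k`. -/
theorem IsBestLowRank.sqrt_frobSq_sub_le {n k : ℕ} {T Q R : Matrix (Fin n) (Fin n) ℝ}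
    (hQ : IsBestLowRank k T Q) (hR : R.rank ≤ k) {K : ℝ} (hK : 0 ≤ K)
    (hT : OpBound (T - R) K) : √(frobSq (Q - R)) ≤ 2 * (K * √(2 * k)) := by
  have h1 := hQ.2 R hR
  have h2 : frobSq (T - Q) = frobSq (T - R) - 2 * (∑ i, ∑ j, (T - R) i j * (Q - R) i j) +
      frobSq (Q - R) := by
    simp only [frobSq, Finset.mul_sum, ← Finset.sum_sub_distrib, ← Finset.sum_add_distrib,
      Matrix.sub_apply]
    refine Finset.sum_congr rfl fun i _ => Finset.sum_congr rfl fun j _ => ?_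
    ring
  have h3 := hT.sum_mul_le (R := Q - R) hK
  have h4 : √((Q - R).rank : ℝ) ≤ √(2 * k) := by
    apply Real.sqrt_le_sqrt
    have : (Q - R).rank ≤ 2 * k := (rank_sub_le Q R).trans (by have := hQ.1; omega)
    exact_mod_cast this
  set f := √(frobSq (Q - R)) with hf
  have hf0 : 0 ≤ f := Real.sqrt_nonneg _
  have hff : f * f = frobSq (Q - R) := Real.mul_self_sqrt (frobSq_nonneg _)
  have h5 : f * f ≤ 2 * (K * √(2 * k)) * f := by
    have : K * (√((Q - R).rank : ℝ) * f) ≤ K * (√(2 * k) * f) := by gcongr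
    nlinarith
  rcases hf0.eq_or_lt with h0 | h0
  · rw [← h0]; positivity
  · exact le_of_mul_le_mul_right h5 h0

/-! ### Weighted `k`-medians -/

section L1

variable {n : ℕ}

lemma l1_nonneg (v : Fin n → ℝ) : 0 ≤ l1 v := Finset.sum_nonneg fun _ _ => abs_nonneg _

lemma l1_smul (c : ℝ) (v : Fin n → ℝ) : l1 (c • v) = |c| * l1 v := by
  simp only [l1, Pi.smul_apply, smul_eq_mul, abs_mul, Finset.mul_sum]

lemma l1_sub_comm (a b : Fin n → ℝ) : l1 (a - b) = l1 (b - a) := by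
  simp only [l1, Pi.sub_apply, abs_sub_comm]

lemma l1_sub_le (a b c : Fin n → ℝ) : l1 (a - c) ≤ l1 (a - b) + l1 (b - c) := by
  simp only [l1, Pi.sub_apply, ← Finset.sum_add_distrib]
  exact Finset.sum_le_sum fun _ _ => abs_sub_le _ _ _

lemma l1_le_add (a b : Fin n → ℝ) : l1 a ≤ l1 b + l1 (a - b) := by
  have := l1_sub_le a b 0
  simp only [sub_zero] at this
  linarith

lemma abs_l1_sub_l1_le (a b : Fin n → ℝ) : |l1 a - l1 b| ≤ l1 (a - b) := by
  rw [abs_le]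
  have h1 := l1_le_add a b
  have h2 := l1_le_add b a
  rw [l1_sub_comm] at h2
  constructor <;> linarith

/-- Normalizing a row at most doubles its distance to a multiple of a unit vector. -/
lemma l1_mul_l1_normalize_sub_le {q ν : Fin n → ℝ} (hq : l1 q ≠ 0) (hν : l1 ν = 1) {w : ℝ}
    (hw : 0 ≤ w) : l1 q * l1 ((l1 q)⁻¹ • q - ν) ≤ 2 * l1 (q - w • ν) := by
  have h1 : l1 q * l1 ((l1 q)⁻¹ • q - ν) = l1 (q - l1 q • ν) := by
    conv_lhs => rw [← abs_of_nonneg (l1_nonneg q)]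
    rw [← l1_smul, smul_sub, abs_of_nonneg (l1_nonneg q), smul_smul, mul_inv_cancel₀ hq, one_smul]
  have h2 : l1 (w • ν - l1 q • ν) = |l1 q - w| := by
    rw [← sub_smul, l1_smul, hν, mul_one, abs_sub_comm]
  have h3 : |l1 q - w| ≤ l1 (q - w • ν) := by
    have := abs_l1_sub_l1_le q (w • ν)
    rwa [l1_smul, hν, mul_one, abs_of_nonneg hw] at this
  have h4 := l1_sub_le q (w • ν) (l1 q • ν)
  rw [h1]
  linarith

lemma sum_l1_row_le (M : Matrix (Fin n) (Fin n) ℝ) : ∑ i, l1 (M i) ≤ n * √(frobSq M) := by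
  have h1 := Real.sum_mul_le_sqrt_mul_sqrt (Finset.univ : Finset (Fin n × Fin n))
    (fun _ => 1) (fun e => |M e.1 e.2|)
  simp only [one_mul, one_pow, sq_abs, Fintype.sum_prod_type] at h1
  refine h1.trans (le_of_eq ?_)
  simp only [frobSq, Finset.sum_const, Finset.card_univ, Fintype.card_fin, nsmul_eq_mul, mul_one,
    Real.sqrt_mul_self (Nat.cast_nonneg n)]

end L1

lemma kMediansCost_some_le {n k : ℕ} {Q : Matrix (Fin n) (Fin n) ℝ} {z : Fin n → Fin k}
    {ν : Fin k → Fin n → ℝ} {w : Fin n → ℝ} (hν : ∀ u, l1 (ν u) = 1) (hw : ∀ i, 0 ≤ w i) :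
    kMediansCost Q (fun i => some (z i)) ≤ 2 * ∑ i, l1 (Q i - w i • ν (z i)) := by
  classical
  calc kMediansCost Q (fun i => some (z i))
      ≤ ∑ u, ∑ i, if z i = u then 2 * l1 (Q i - w i • ν (z i)) else 0 := by
        refine Finset.sum_le_sum fun u _ => (ciInf_le ⟨0, ?_⟩ (ν u)).trans ?_
        · rintro _ ⟨v, rfl⟩
          exact Finset.sum_nonneg fun i _ => mul_nonneg (l1_nonneg _) (l1_nonneg _)
        · rw [Finset.sum_filter]
          refine Finset.sum_le_sum fun i _ => ?_
          by_cases h : z i = u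
          · subst h
            split_ifs with h1 h2
            · exact l1_mul_l1_normalize_sub_le h1.1 (hν _) (hw i)
            · simp at h2
            · have := l1_nonneg (Q i - w i • ν (z i))
              positivity
            · simp at *
          · simp [h]
    _ = _ := by
        rw [Finset.sum_comm, Finset.mul_sum]
        refine Finset.sum_congr rfl fun i _ => ?_
        simp

/-- Centers optimal up to `η`, so that attainment of the infima is not needed; `c i` is the cost of
the node `i`. -/
lemma exists_centers {n k : ℕ} (Q : Matrix (Fin n) (Fin n) ℝ) (zhat : Fin n → Option (Fin k))
    {η : ℝ} (hη : 0 < η) : ∃ (v : Fin k → Fin n → ℝ) (c : Fin n → ℝ), (∀ i, 0 ≤ c i) ∧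
      (∀ i u, l1 (Q i) ≠ 0 → zhat i = some u →
        c i = l1 (Q i) * l1 ((l1 (Q i))⁻¹ • Q i - v u)) ∧
      ∑ i, c i ≤ kMediansCost Q zhat + η := by
  classical
  rcases Nat.eq_zero_or_pos k with rfl | hk
  · refine ⟨fun u => u.elim0, fun _ => 0, fun _ => le_rfl, fun i u => u.elim0, ?_⟩
    simp [kMediansCost, hη.le]
  have hk' : (0 : ℝ) < k := by exact_mod_cast hk
  have hex : ∀ u : Fin k, ∃ v : Fin n → ℝ,
      ∑ i with l1 (Q i) ≠ 0 ∧ zhat i = some u, l1 (Q i) * l1 ((l1 (Q i))⁻¹ • Q i - v) <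
      (⨅ v : Fin n → ℝ, ∑ i with l1 (Q i) ≠ 0 ∧ zhat i = some u,
        l1 (Q i) * l1 ((l1 (Q i))⁻¹ • Q i - v)) + η / k := fun u =>
    exists_lt_of_ciInf_lt (lt_add_of_pos_right _ (by positivity))
  choose v hv using hex
  refine ⟨v, fun i => ∑ u, if l1 (Q i) ≠ 0 ∧ zhat i = some u then
    l1 (Q i) * l1 ((l1 (Q i))⁻¹ • Q i - v u) else 0, fun i => ?_, fun i u h1 h2 => ?_, ?_⟩
  · refine Finset.sum_nonneg fun u _ => ?_
    split_ifs
    · exact mul_nonneg (l1_nonneg _) (l1_nonneg _)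
    · exact le_rfl
  · simp [h1, h2]
  · rw [Finset.sum_comm]
    calc _ ≤ ∑ u : Fin k, ((⨅ v : Fin n → ℝ, ∑ i with l1 (Q i) ≠ 0 ∧ zhat i = some u,
          l1 (Q i) * l1 ((l1 (Q i))⁻¹ • Q i - v)) + η / k) := by
          refine Finset.sum_le_sum fun u _ => ?_
          rw [← Finset.sum_filter]
          exact (hv u).le
      _ = kMediansCost Q zhat + η := by
          rw [Finset.sum_add_distrib, kMediansCost]
          congr 1
          · rw [Finset.sum_const, Finset.card_univ, Fintype.card_fin, nsmul_eq_mul,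
              mul_div_cancel₀ _ hk'.ne']

/-- All but a light set `S` of nodes are close, after normalization, to the center of their
estimated cluster; for the others, equal labels mean equal communities. -/
theorem exists_bad_set {n k : ℕ} {Q : Matrix (Fin n) (Fin n) ℝ} {z : Fin n → Fin k}
    {zhat : Fin n → Option (Fin k)} {ν : Fin k → Fin n → ℝ} {w : Fin n → ℝ} {ε E sep : ℝ}
    (hν : ∀ u, l1 (ν u) = 1) (hw : ∀ i, 0 ≤ w i) (hE : 0 < E) (hε : 0 ≤ ε)
    (hQ : ∑ i, l1 (Q i - w i • ν (z i)) ≤ E) (hnone : ∀ i, zhat i = none ↔ l1 (Q i) = 0)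
    (hcost : kMediansCost Q zhat ≤ (1 + ε) * kMediansCost Q (fun i => some (z i)))
    (hsep0 : 0 < sep) (hsep2 : sep ≤ 2) (hsep : ∀ u v, u ≠ v → sep ≤ l1 (ν u - ν v)) :
    ∃ S : Finset (Fin n), (∀ i, i ∉ S → zhat i ≠ none) ∧
      (∀ i j, i ∉ S → j ∉ S → zhat i = zhat j → z i = z j) ∧
      ∑ i ∈ S, w i ≤ 12 * (1 + ε) * E / sep := by
  classical
  obtain ⟨v, c, hc0, hc, hcsum⟩ := exists_centers Q zhat hE
  set r : Fin n → ℝ := fun i => l1 (Q i - w i • ν (z i)) with hr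
  have hr0 : ∀ i, 0 ≤ r i := fun i => l1_nonneg _
  set S : Finset (Fin n) := Finset.univ.filter fun i =>
    zhat i = none ∨ ∃ u, zhat i = some u ∧ sep / 2 ≤ l1 (ν (z i) - v u) with hS
  refine ⟨S, fun i hi h => hi (by simp [hS, h]), fun i j hi hj hij => ?_, ?_⟩
  · by_contra hne
    rcases hu : zhat i with _ | u
    · exact hi (by simp [hS, hu])
    have hi' : l1 (ν (z i) - v u) < sep / 2 := by
      by_contra hcon
      exact hi (by simpa [hS, hu] using not_lt.1 hcon)
    have hj' : l1 (ν (z j) - v u) < sep / 2 := by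
      by_contra hcon
      exact hj (by simpa [hS, ← hij, hu] using not_lt.1 hcon)
    have h1 := hsep _ _ hne
    have h2 := l1_sub_le (ν (z i)) (v u) (ν (z j))
    rw [l1_sub_comm (v u)] at h2
    linarith
  · have hwQ : ∀ i, w i ≤ l1 (Q i) + r i := by
      intro i
      have := l1_le_add (w i • ν (z i)) (Q i)
      rwa [l1_smul, hν, mul_one, abs_of_nonneg (hw i), l1_sub_comm] at this
    have hle : ∀ i, r i ≤ 2 / sep * r i := fun i =>
      le_mul_of_one_le_left (hr0 i) ((one_le_div hsep0).2 hsep2)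
    have hbad : ∀ i ∈ S, w i ≤ 2 / sep * (c i + 3 * r i) := by
      intro i hi
      have hci : 0 ≤ 2 / sep * c i := mul_nonneg (by positivity) (hc0 i)
      have hri : 0 ≤ 2 / sep * r i := mul_nonneg (by positivity) (hr0 i)
      have h0 := hwQ i
      have h1 := hle i
      rcases (Finset.mem_filter.1 hi).2 with h | ⟨u, hu, h⟩
      · rw [(hnone i).1 h] at h0
        linarith
      · have hne : l1 (Q i) ≠ 0 := by
          intro h3
          rw [(hnone i).2 h3] at hu
          exact Option.some_ne_none u hu.symm
        have h2 := hc i u hne hu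
        have h3 : l1 (Q i) * l1 ((l1 (Q i))⁻¹ • Q i - ν (z i)) ≤ 2 * r i :=
          l1_mul_l1_normalize_sub_le hne (hν _) (hw i)
        have h4 := l1_sub_le (ν (z i)) ((l1 (Q i))⁻¹ • Q i) (v u)
        rw [l1_sub_comm (ν (z i)) ((l1 (Q i))⁻¹ • Q i)] at h4
        have h5 : l1 (Q i) * (sep / 2) ≤ c i + 2 * r i := by
          have := mul_le_mul_of_nonneg_left (h.trans h4) (l1_nonneg (Q i))
          rw [mul_add] at this
          linarith
        have h6 : l1 (Q i) ≤ 2 / sep * (c i + 2 * r i) := by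
          rw [div_mul_eq_mul_div, le_div_iff₀ hsep0]
          linarith
        linarith
    have hcz := kMediansCost_some_le (Q := Q) (z := z) hν hw
    have hcz' : (1 + ε) * kMediansCost Q (fun i => some (z i)) ≤ (1 + ε) * (2 * E) := by
      gcongr
      linarith
    calc ∑ i ∈ S, w i ≤ ∑ i ∈ S, 2 / sep * (c i + 3 * r i) := Finset.sum_le_sum hbad
      _ ≤ ∑ i, 2 / sep * (c i + 3 * r i) :=
          Finset.sum_le_sum_of_subset_of_nonneg (Finset.subset_univ _) fun i _ _ => by
            have := hc0 i
            have := hr0 i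
            positivity
      _ = 2 / sep * (∑ i, c i + 3 * ∑ i, r i) := by
          rw [← Finset.mul_sum, Finset.sum_add_distrib, ← Finset.mul_sum]
      _ ≤ 2 / sep * (6 * (1 + ε) * E) := by
          gcongr
          nlinarith [mul_nonneg hε hE.le]
      _ = _ := by ring

/-! ### Matching the labels -/

/-- A community without a node outside `S` contributes its whole weight to `S`, while at most as
many communities carry several labels outside `S`. Giving up the latter costs no more than a
constant factor, as the community weights are comparable. -/
theorem misclassLoss_le {n k : ℕ} {θ : Fin n → ℝ} {z : Fin n → Fin k}
    {zhat : Fin n → Option (Fin k)} {S : Finset (Fin n)} {a b : ℝ} (hθ : ∀ i, 0 ≤ θ i)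
    (hnone : ∀ i, i ∉ S → zhat i ≠ none)
    (hS : ∀ i j, i ∉ S → j ∉ S → zhat i = zhat j → z i = z j) (ha : 0 < a)
    (hlow : ∀ u, a ≤ ∑ i with z i = u, θ i) (hup : ∀ u, ∑ i with z i = u, θ i ≤ b) :
    misclassLoss θ z zhat ≤ (1 + b / a) * ∑ i ∈ S, θ i := by
  classical
  set Lab : Fin k → Finset (Fin k) := fun u =>
    Finset.univ.filter fun l => ∃ i, i ∉ S ∧ z i = u ∧ zhat i = some l with hLab
  have memLab (u l) : l ∈ Lab u ↔ ∃ i, i ∉ S ∧ z i = u ∧ zhat i = some l := by simp [hLab]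
  have hdisj : ∀ u l u', l ∈ Lab u → l ∈ Lab u' → u = u' := by
    intro u l u' h h'
    obtain ⟨i, hi, rfl, hil⟩ := (memLab _ _).1 h
    obtain ⟨j, hj, rfl, hjl⟩ := (memLab _ _).1 h'
    exact hS i j hi hj (hil.trans hjl.symm)
  set G : Finset (Fin k) := Finset.univ.filter fun u => 0 < (Lab u).card with hG
  set T : Finset (Fin k) := Finset.univ.filter fun u => 2 ≤ (Lab u).card with hT
  have hcard : G.card + T.card ≤ k := by
    have h1 : ∑ u, (Lab u).card ≤ k := by
      rw [← Finset.card_biUnion]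
      · simpa using (Finset.univ.biUnion Lab).card_le_univ
      · intro u _ u' _ hne
        exact Finset.disjoint_left.2 fun l h h' => hne (hdisj u l u' h h')
    refine le_trans ?_ h1
    rw [Finset.card_filter, Finset.card_filter, ← Finset.sum_add_distrib]
    refine Finset.sum_le_sum fun u _ => ?_
    split_ifs <;> omega
  have hex : ∀ u, ∃ l, u ∈ G → l ∈ Lab u := by
    intro u
    by_cases h : u ∈ G
    · obtain ⟨l, hl⟩ := Finset.card_pos.1 (Finset.mem_filter.1 h).2
      exact ⟨l, fun _ => hl⟩
    · exact ⟨u, fun h' => absurd h' h⟩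
  choose f hf using hex
  have hinj : Set.InjOn f G := fun u hu u' hu' h =>
    hdisj u (f u) u' (hf u hu) (h ▸ hf u' hu')
  obtain ⟨g, hg⟩ := Finset.exists_equiv_extend_of_card_eq (t := (Finset.univ : Finset (Fin k)))
    (by simp) (Finset.subset_univ (G.image f)) hinj
  set π : Equiv.Perm (Fin k) := g.trans (Equiv.subtypeUnivEquiv Finset.mem_univ) with hπ
  have hπG : ∀ u ∈ G, π u = f u := fun u hu => hg u hu
  -- a node outside `S` whose community carries a single label there is labelled correctly
  have hmis : ∀ i, zhat i ≠ some (π (z i)) → i ∉ S → z i ∈ T := by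
    intro i hi hiS
    obtain ⟨l, hl⟩ := Option.ne_none_iff_exists'.1 (hnone i hiS)
    have hlL : l ∈ Lab (z i) := (memLab _ _).2 ⟨i, hiS, rfl, hl⟩
    have huG : z i ∈ G := Finset.mem_filter.2 ⟨Finset.mem_univ _, Finset.card_pos.2 ⟨l, hlL⟩⟩
    refine Finset.mem_filter.2 ⟨Finset.mem_univ _, Finset.one_lt_card.2
      ⟨l, hlL, f (z i), hf _ huG, fun h => hi ?_⟩⟩
    rw [hl, hπG _ huG, h]
  have hbG : ((k : ℝ) - G.card) * a ≤ ∑ i ∈ S, θ i := by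
    have h1 : ((k : ℝ) - G.card) = (Gᶜ.card : ℝ) := by
      rw [Finset.card_compl, Fintype.card_fin, Nat.cast_sub (by omega)]
    rw [h1, ← nsmul_eq_mul]
    calc Gᶜ.card • a ≤ ∑ u ∈ Gᶜ, ∑ i with z i = u, θ i :=
          Finset.card_nsmul_le_sum _ _ _ fun u _ => hlow u
      _ = ∑ i ∈ Gᶜ.biUnion fun u => Finset.univ.filter fun i => z i = u, θ i := by
          rw [Finset.sum_biUnion]
          intro u _ u' _ hne
          exact Finset.disjoint_left.2 fun i h h' =>
            hne ((Finset.mem_filter.1 h).2.symm.trans (Finset.mem_filter.1 h').2)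
      _ ≤ ∑ i ∈ S, θ i := by
          refine Finset.sum_le_sum_of_subset_of_nonneg (fun i hi => ?_) fun i _ _ => hθ i
          simp only [Finset.mem_biUnion, Finset.mem_compl, Finset.mem_filter, Finset.mem_univ,
            true_and] at hi
          obtain ⟨u, hu, rfl⟩ := hi
          by_contra hiS
          obtain ⟨l, hl⟩ := Option.ne_none_iff_exists'.1 (hnone i hiS)
          exact hu (Finset.mem_filter.2 ⟨Finset.mem_univ _, Finset.card_pos.2
            ⟨l, (memLab _ _).2 ⟨i, hiS, rfl, hl⟩⟩⟩)
  have hTb : ∑ u ∈ T, ∑ i with z i = u, θ i ≤ b / a * ∑ i ∈ S, θ i := by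
    rcases T.eq_empty_or_nonempty with h0 | ⟨u₀, _⟩
    · have hb : 0 ≤ b / a * ∑ i ∈ S, θ i := by
        rcases isEmpty_or_nonempty (Fin k) with hk | ⟨⟨u⟩⟩
        · have : S = ∅ := Finset.eq_empty_of_forall_notMem fun i _ => hk.elim (z i)
          simp [this]
        · have := ha.le.trans ((hlow u).trans (hup u))
          have := Finset.sum_nonneg fun i (_ : i ∈ S) => hθ i
          positivity
      simpa [h0] using hb
    · have hb : 0 ≤ b := ha.le.trans ((hlow u₀).trans (hup u₀))
      have h1 : (T.card : ℝ) ≤ k - G.card := by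
        have : (G.card : ℝ) + T.card ≤ k := by exact_mod_cast hcard
        linarith
      calc ∑ u ∈ T, ∑ i with z i = u, θ i ≤ T.card • b :=
            Finset.sum_le_card_nsmul _ _ _ fun u _ => hup u
        _ = b / a * (T.card * a) := by
            rw [nsmul_eq_mul, mul_comm (T.card : ℝ) a, ← mul_assoc, div_mul_cancel₀ _ ha.ne',
              mul_comm]
        _ ≤ b / a * ∑ i ∈ S, θ i :=
            mul_le_mul_of_nonneg_left ((mul_le_mul_of_nonneg_right h1 ha.le).trans hbG)
              (div_nonneg hb ha.le)
  have hloss : misclassLoss θ z zhat ≤ ∑ i with zhat i ≠ some (π (z i)), θ i := by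
    refine (ciInf_le (Set.finite_range _).bddBelow π).trans (le_of_eq ?_)
    refine Finset.sum_congr ?_ fun _ _ => rfl
    ext i; simp
  calc misclassLoss θ z zhat ≤ ∑ i with zhat i ≠ some (π (z i)), θ i := hloss
    _ ≤ ∑ i ∈ S ∪ T.biUnion fun u => Finset.univ.filter fun i => z i = u, θ i := by
        refine Finset.sum_le_sum_of_subset_of_nonneg (fun i hi => ?_) fun i _ _ => hθ i
        by_cases hiS : i ∈ S
        · exact Finset.mem_union_left _ hiS
        · refine Finset.mem_union_right _ (Finset.mem_biUnion.2
            ⟨z i, hmis i (Finset.mem_filter.1 hi).2 hiS, by simp⟩)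
    _ ≤ ∑ i ∈ S, θ i + ∑ i ∈ T.biUnion fun u => Finset.univ.filter fun i => z i = u, θ i := by
        rw [← Finset.sum_union_inter]
        exact le_add_of_nonneg_right (Finset.sum_nonneg fun i _ => hθ i)
    _ = ∑ i ∈ S, θ i + ∑ u ∈ T, ∑ i with z i = u, θ i := by
        rw [Finset.sum_biUnion]
        intro u _ u' _ hne
        exact Finset.disjoint_left.2 fun i h h' =>
          hne ((Finset.mem_filter.1 h).2.symm.trans (Finset.mem_filter.1 h').2)
    _ ≤ _ := by rw [add_mul, one_mul]; linarith

/-! ### Degree-corrected block models -/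

/-- The expected adjacency matrix with its diagonal filled in, which has rank at most `k`. -/
def fullMatrix {n k : ℕ} (θ : Fin n → ℝ) (z : Fin n → Fin k) (B : Matrix (Fin k) (Fin k) ℝ) :
    Matrix (Fin n) (Fin n) ℝ :=
  Matrix.of fun i j => θ i * θ j * B (z i) (z j)

lemma rank_fullMatrix_le {n k : ℕ} (θ : Fin n → ℝ) (z : Fin n → Fin k)
    (B : Matrix (Fin k) (Fin k) ℝ) : (fullMatrix θ z B).rank ≤ k := by
  have h : fullMatrix θ z B = (Matrix.of fun i u => if z i = u then θ i else 0) *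
      (Matrix.of fun u j => θ j * B u (z j)) := by
    ext i j
    simp [fullMatrix, Matrix.mul_apply, mul_assoc]
  rw [h]
  exact (Matrix.rank_mul_le_left _ _).trans (Matrix.rank_le_width _)

lemma probMatrix_sub_fullMatrix {n k : ℕ} (θ : Fin n → ℝ) (z : Fin n → Fin k)
    (B : Matrix (Fin k) (Fin k) ℝ) : probMatrix θ z B - fullMatrix θ z B =
      Matrix.diagonal fun i => -(θ i * θ i * B (z i) (z i)) := by
  ext i j
  rcases eq_or_ne i j with rfl | h
  · simp [probMatrix, fullMatrix]
  · simp [probMatrix, fullMatrix, h]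

/-- `∑_j θ_j B_{u z(j)}`: the `ℓ₁` norm of the rows of community `u`, relative to the degree
parameter of the row. -/
def rowMass {n k : ℕ} (θ : Fin n → ℝ) (z : Fin n → Fin k) (B : Matrix (Fin k) (Fin k) ℝ)
    (u : Fin k) : ℝ := ∑ j, θ j * B u (z j)

/-- The common normalization of the rows of community `u`. -/
noncomputable def rowProfile {n k : ℕ} (θ : Fin n → ℝ) (z : Fin n → Fin k)
    (B : Matrix (Fin k) (Fin k) ℝ) (u : Fin k) : Fin n → ℝ :=
  fun j => θ j * B u (z j) / rowMass θ z B u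

section Model

variable {n k : ℕ} {θ : Fin n → ℝ} {p q α β δ : ℝ} {z : Fin n → Fin k}
  {B : Matrix (Fin k) (Fin k) ℝ}

lemma MemSpace.commSize_pos (h : MemSpace θ p q β δ z B) (hδ : δ ≤ 1 / 2) (u : Fin k) :
    0 < commSize z u := by
  by_contra hcon
  have h0 : commSize z u = 0 := by omega
  have := (h.normalized u).1
  rw [h0] at this
  simp only [Nat.cast_zero, div_zero, zero_mul] at this
  linarith

lemma MemSpace.sum_comm_mem (h : MemSpace θ p q β δ z B) (hδ : δ ≤ 1 / 2) (u : Fin k) :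
    (commSize z u : ℝ) / 2 ≤ ∑ i with z i = u, θ i ∧
      ∑ i with z i = u, θ i ≤ 3 / 2 * commSize z u := by
  have hpos : (0 : ℝ) < commSize z u := by exact_mod_cast h.commSize_pos hδ u
  have hn := h.normalized u
  rw [Set.mem_Icc, one_div_mul_eq_div, le_div_iff₀ hpos, div_le_iff₀ hpos] at hn
  constructor <;> nlinarith [hn.1, hn.2]

lemma le_norm_degree (θ : Fin n → ℝ) (i : Fin n) : θ i ≤ ‖θ‖ :=
  (le_abs_self _).trans (norm_le_pi_norm θ i)

lemma sum_comm_le_commSize_mul {c : ℝ} (hc : ∀ i, θ i ≤ c) (u : Fin k) :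
    ∑ i with z i = u, θ i ≤ commSize z u * c := by
  have h := Finset.sum_le_card_nsmul (Finset.univ.filter fun i => z i = u) θ c fun i _ => hc i
  rw [nsmul_eq_mul] at h
  refine h.trans (le_of_eq ?_)
  congr 3

/-- Since some `θ_i ≥ 1/2`, the bound on `‖θ‖` forces the communities to be large. -/
lemma MemSpace.eight_le (h : MemSpace θ p q β δ z B) (hδ : δ ≤ 1 / 2) (u : Fin k)
    (hsmall : ‖θ‖ ≤ n / (β * k) / 16) : 8 ≤ (n : ℝ) / (β * k) := by
  have hpos : (0 : ℝ) < commSize z u := by exact_mod_cast h.commSize_pos hδ u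
  have h1 := (h.sum_comm_mem hδ u).1
  have h2 := sum_comm_le_commSize_mul (z := z) (le_norm_degree θ) u
  have h3 : (1 / 2 : ℝ) ≤ ‖θ‖ := by
    refine le_of_mul_le_mul_left ?_ hpos
    linarith
  linarith

lemma MemSpace.comm_bounds (h : MemSpace θ p q β δ z B) (hδ : δ ≤ 1 / 2) (hβ : 1 ≤ β)
    (hsmall : ‖θ‖ ≤ n / (β * k) / 16) (u : Fin k) :
    (n : ℝ) / (β * k) / 2 ≤ commSize z u ∧ n / (β * k) / 4 ≤ ∑ i with z i = u, θ i ∧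
      ∑ i with z i = u, θ i ≤ 3 * β ^ 2 * (n / (β * k)) := by
  have h8 := h.eight_le hδ u hsmall
  have h1 := h.le_size u
  have h2 := h.size_le u
  have h3 := h.sum_comm_mem hδ u
  have h4 : β * n / k = β ^ 2 * (n / (β * k)) := by
    have : β ≠ 0 := by linarith
    field_simp
  rw [h4] at h2
  refine ⟨by linarith, by linarith, h3.2.trans ?_⟩
  nlinarith

lemma MemSpace'.B_le (h : MemSpace' θ p q β δ α z B) (u v : Fin k) : B u v ≤ α * p := by
  rcases eq_or_ne u v with rfl | huv
  · exact h.within_le u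
  · have h1 := h.between_le u v huv
    have h2 := h.lt
    have h3 := h.le_within u
    have h4 := h.within_le u
    linarith

lemma MemSpace.B_nonneg (h : MemSpace θ p q β δ z B) (hδ : δ ≤ 1 / 2) (hp : 0 ≤ p)
    (u v : Fin k) : 0 ≤ B u v := by
  rcases eq_or_ne u v with rfl | huv
  · exact hp.trans (h.le_within u)
  have hpos (u : Fin k) : ∃ i, z i = u ∧ 0 < θ i := by
    by_contra hcon
    push Not at hcon
    have h1 : ∑ i with z i = u, θ i ≤ 0 :=
      Finset.sum_nonpos fun i hi => hcon i (Finset.mem_filter.1 hi).2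
    have h2 : (0 : ℝ) < commSize z u := by exact_mod_cast h.commSize_pos hδ u
    linarith [(h.sum_comm_mem hδ u).1]
  obtain ⟨i, rfl, hi⟩ := hpos u
  obtain ⟨j, rfl, hj⟩ := hpos v
  have hij : i ≠ j := fun e => huv (congrArg z e)
  have h1 := (h.prob_mem i j).1
  simp only [probMatrix, Matrix.of_apply, hij, if_false] at h1
  exact nonneg_of_mul_nonneg_right h1 (mul_pos hi hj)

/-- Were `p θ_i > 4`, the constraint `P_{ij} ≤ 1` would force `θ_j ≤ 1/4` for all other nodes `j`
of the community, contradicting the normalization. -/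
lemma MemSpace.mul_degree_le (h : MemSpace θ p q β δ z B) (hθ : ∀ i, 0 ≤ θ i)
    (hδ : δ ≤ 1 / 2) (hβ : 1 ≤ β) (hsmall : ‖θ‖ ≤ n / (β * k) / 16) (i : Fin n) :
    p * θ i ≤ 4 := by
  by_contra hcon
  push Not at hcon
  obtain ⟨h1, -, -⟩ := h.comm_bounds hδ hβ hsmall (z i)
  have hpos : (0 : ℝ) < commSize z (z i) := by exact_mod_cast h.commSize_pos hδ (z i)
  have h2 := (h.sum_comm_mem hδ (z i)).1
  have h3 : ∀ j, z j = z i → j ≠ i → θ j ≤ 1 / 4 := by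
    intro j hj hji
    have h4 := (h.prob_mem i j).2
    simp only [probMatrix, Matrix.of_apply, hji.symm, if_false, hj] at h4
    have h5 : θ i * θ j * p ≤ θ i * θ j * B (z i) (z i) :=
      mul_le_mul_of_nonneg_left (h.le_within _) (mul_nonneg (hθ i) (hθ j))
    have h6 : 4 * θ j ≤ p * θ i * θ j := mul_le_mul_of_nonneg_right hcon.le (hθ j)
    linarith
  have h7 : ∑ j with z j = z i, θ j ≤ θ i + commSize z (z i) * (1 / 4) := by
    calc ∑ j with z j = z i, θ j
        ≤ ∑ j with z j = z i, ((if j = i then θ i else 0) + 1 / 4) := by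
          refine Finset.sum_le_sum fun j hj => ?_
          have hj' := (Finset.mem_filter.1 hj).2
          split_ifs with hji
          · subst hji; linarith
          · linarith [h3 j hj' hji]
      _ ≤ _ := by
          rw [Finset.sum_add_distrib]
          refine add_le_add ?_ (sum_comm_le_commSize_mul (θ := fun _ => 1 / 4)
            (fun _ => le_rfl) _)
          rw [Finset.sum_ite_eq']
          split_ifs
          · exact le_rfl
          · exact hθ i
  have h8 := le_norm_degree θ i
  linarith

lemma rowMass_bounds (h : MemSpace' θ p q β δ α z B) (hθ : ∀ i, 0 ≤ θ i) (hδ : δ ≤ 1 / 2)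
    (hβ : 1 ≤ β) (hp : 0 < p) (hα : 0 ≤ α) (hsmall : ‖θ‖ ≤ n / (β * k) / 16) (u : Fin k) :
    p * (n / (β * k) / 4) ≤ rowMass θ z B u ∧ rowMass θ z B u ≤ 3 * α * β * p * n := by
  have hB := h.B_nonneg hδ hp.le
  have hk : (0 : ℝ) < k := by exact_mod_cast (Nat.zero_lt_of_lt u.isLt)
  constructor
  · calc p * (n / (β * k) / 4) ≤ p * ∑ i with z i = u, θ i := by
          gcongr
          exact (h.comm_bounds hδ hβ hsmall u).2.1
      _ ≤ ∑ i with z i = u, θ i * B u (z i) := by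
          rw [Finset.mul_sum]
          refine Finset.sum_le_sum fun i hi => ?_
          rw [(Finset.mem_filter.1 hi).2, mul_comm]
          exact mul_le_mul_of_nonneg_left (h.le_within u) (hθ i)
      _ ≤ _ := Finset.sum_le_sum_of_subset_of_nonneg (Finset.filter_subset _ _)
          fun i _ _ => mul_nonneg (hθ i) (hB _ _)
  · have h1 : ∑ i, θ i ≤ 3 * β * n := by
      rw [← Finset.sum_fiberwise _ z]
      refine (Finset.sum_le_card_nsmul _ _ _ fun v _ =>
        (h.comm_bounds hδ hβ hsmall v).2.2).trans (le_of_eq ?_)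
      rw [Finset.card_univ, Fintype.card_fin, nsmul_eq_mul]
      have : β ≠ 0 := by linarith
      field_simp
    calc rowMass θ z B u ≤ ∑ i, θ i * (α * p) :=
          Finset.sum_le_sum fun i _ => mul_le_mul_of_nonneg_left (h.B_le _ _) (hθ i)
      _ = (∑ i, θ i) * (α * p) := by rw [Finset.sum_mul]
      _ ≤ (3 * β * n) * (α * p) := by gcongr
      _ = _ := by ring

lemma l1_rowProfile (hθ : ∀ i, 0 ≤ θ i) (hB : ∀ u v, 0 ≤ B u v) {u : Fin k}
    (hu : 0 < rowMass θ z B u) : l1 (rowProfile θ z B u) = 1 := by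
  calc l1 (rowProfile θ z B u) = ∑ j, θ j * B u (z j) / rowMass θ z B u :=
        Finset.sum_congr rfl fun j _ => abs_of_nonneg
          (div_nonneg (mul_nonneg (hθ j) (hB _ _)) hu.le)
    _ = 1 := by rw [← Finset.sum_div]; exact div_self hu.ne'

/-- The profiles of two communities differ on the community with the smaller row mass. -/
lemma rowProfile_separated (h : MemSpace' θ p q β δ α z B) (hθ : ∀ i, 0 ≤ θ i)
    (hδ : δ ≤ 1 / 2) (hβ : 1 ≤ β) (hp : 0 < p) (hα : 1 ≤ α)
    (hsmall : ‖θ‖ ≤ n / (β * k) / 16) {u v : Fin k} (huv : u ≠ v) :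
    (p - q) / (12 * α * β ^ 2 * p * k) ≤ l1 (rowProfile θ z B u - rowProfile θ z B v) := by
  have hα0 : 0 ≤ α := by linarith
  wlog huv' : rowMass θ z B u ≤ rowMass θ z B v generalizing u v
  · rw [l1_sub_comm]
    exact this huv.symm (le_of_not_ge huv')
  have hB := h.B_nonneg hδ hp.le
  have hk : (0 : ℝ) < k := by exact_mod_cast (Nat.zero_lt_of_lt u.isLt)
  have hβ0 : 0 < β := by linarith
  have h8 := h.eight_le hδ u hsmall
  obtain ⟨h1, h2⟩ := rowMass_bounds h hθ hδ hβ hp hα0 hsmall u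
  set D := rowMass θ z B u
  set D' := rowMass θ z B v
  have hD : 0 < D := lt_of_lt_of_le (by positivity) h1
  have hn : (0 : ℝ) < n := by
    rcases (Nat.cast_nonneg (α := ℝ) n).eq_or_lt with h0 | h0
    · rw [← h0] at h8; norm_num at h8
    · exact h0
  have hpq : 0 < p - q := sub_pos.2 h.lt
  calc (p - q) / (12 * α * β ^ 2 * p * k)
      = (n / (β * k) / 4) * ((p - q) / (3 * α * β * p * n)) := by field_simp; norm_num
    _ ≤ (∑ j with z j = u, θ j) * ((p - q) / D) := by
        gcongr
        · exact Finset.sum_nonneg fun i _ => hθ i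
        · exact (h.comm_bounds hδ hβ hsmall u).2.1
    _ ≤ ∑ j with z j = u, |(rowProfile θ z B u - rowProfile θ z B v) j| := by
        rw [Finset.sum_mul]
        refine Finset.sum_le_sum fun j hj => le_trans ?_ (le_abs_self _)
        have hj' := (Finset.mem_filter.1 hj).2
        simp only [Pi.sub_apply, rowProfile, hj']
        have h3 : θ j * B v u / D' ≤ θ j * q / D := by
          have hθj := hθ j
          have := hB v u
          exact div_le_div₀ (by have := this.trans (h.between_le v u huv.symm); positivity)
            (mul_le_mul_of_nonneg_left (h.between_le v u huv.symm) hθj) hD huv'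
        have h4 : θ j * p / D ≤ θ j * B u u / D := by
          have := hθ j
          gcongr
          exact h.le_within u
        calc θ j * ((p - q) / D) = θ j * p / D - θ j * q / D := by ring
          _ ≤ _ := by linarith
    _ ≤ _ := Finset.sum_le_sum_of_subset_of_nonneg (Finset.filter_subset _ _)
        fun i _ _ => abs_nonneg _

/-- The deterministic part: a spectral bound for the trimmed matrix bounds the weight of the
misclassified nodes. -/
theorem MemSpace'.misclassLoss_le_of_opBound (h : MemSpace' θ p q β δ α z B)
    (hθ : ∀ i, 0 ≤ θ i) (hδ : δ ≤ 1 / 2) (hβ : 1 ≤ β) (hq : 0 < q) (hα : 1 ≤ α) (hn : 0 < n)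
    (hsmall : ‖θ‖ ≤ n / (β * k) / 16) {A : Matrix (Fin n) (Fin n) ℝ} {τ K ε : ℝ} (hK : 0 < K)
    (hε : 0 ≤ ε) (hop : OpBound (trim τ A - fullMatrix θ z B) K)
    {zhat : Fin n → Option (Fin k)} (hz : IsClusteringOutput τ ε A zhat) :
    misclassLoss θ z zhat ≤ (1 + 12 * β ^ 2) * (2304 * α * β ^ 3) *
      ((1 + ε) * (k : ℝ) ^ (5 / 2 : ℝ) * K / (p - q)) := by
  obtain ⟨Q, hQ, hnone, hcost⟩ := hz
  have hpq : 0 < p - q := sub_pos.2 h.lt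
  have hp : 0 < p := by linarith
  have hn' : (0 : ℝ) < n := by exact_mod_cast hn
  have hk : (0 : ℝ) < k := by exact_mod_cast (Nat.zero_lt_of_lt (z ⟨0, hn⟩).isLt)
  have hk1 : (1 : ℝ) ≤ k := by exact_mod_cast (Nat.zero_lt_of_lt (z ⟨0, hn⟩).isLt)
  have hα0 : 0 < α := by linarith
  have hβ0 : 0 < β := by linarith
  have hB := h.B_nonneg hδ hp.le
  have hX : 0 < (n : ℝ) / (β * k) := by positivity
  have hD (u : Fin k) : 0 < rowMass θ z B u :=
    lt_of_lt_of_le (by positivity) (rowMass_bounds h hθ hδ hβ hp hα0.le hsmall u).1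
  set w : Fin n → ℝ := fun i => θ i * rowMass θ z B (z i) with hw
  have hrow (i : Fin n) : fullMatrix θ z B i = w i • rowProfile θ z B (z i) := by
    funext j
    have := (hD (z i)).ne'
    simp only [fullMatrix, Matrix.of_apply, hw, rowProfile, Pi.smul_apply, smul_eq_mul]
    field_simp
  set E : ℝ := n * (2 * (K * √(2 * k))) with hE
  have hE0 : 0 < E := by positivity
  have hQE : ∑ i, l1 (Q i - w i • rowProfile θ z B (z i)) ≤ E := by
    calc _ = ∑ i, l1 ((Q - fullMatrix θ z B) i) := by
          refine Finset.sum_congr rfl fun i _ => ?_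
          rw [← hrow]; rfl
      _ ≤ n * √(frobSq (Q - fullMatrix θ z B)) := sum_l1_row_le _
      _ ≤ E := mul_le_mul_of_nonneg_left
          (hQ.sqrt_frobSq_sub_le (rank_fullMatrix_le θ z B) hK.le hop) hn'.le
  have hsep2 : (p - q) / (12 * α * β ^ 2 * p * k) ≤ 2 := by
    rw [div_le_iff₀ (by positivity)]
    have : 1 ≤ α * β ^ 2 * k := one_le_mul_of_one_le_of_one_le
      (one_le_mul_of_one_le_of_one_le hα (one_le_pow₀ hβ)) hk1
    nlinarith [mul_le_mul_of_nonneg_left this hp.le]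
  obtain ⟨S, hS1, hS2, hS3⟩ := exists_bad_set (fun u => l1_rowProfile hθ hB (hD u))
    (fun i => mul_nonneg (hθ i) (hD _).le) hE0 hε hQE hnone (hcost z) (by positivity) hsep2
    fun u v huv => rowProfile_separated h hθ hδ hβ hp hα hsmall huv
  have hloss := misclassLoss_le hθ hS1 hS2 (by positivity : 0 < (n : ℝ) / (β * k) / 4)
    (fun u => (h.comm_bounds hδ hβ hsmall u).2.1) (fun u => (h.comm_bounds hδ hβ hsmall u).2.2)
  have hratio : 3 * β ^ 2 * ((n : ℝ) / (β * k)) / (n / (β * k) / 4) = 12 * β ^ 2 := by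
    field_simp; norm_num
  rw [hratio] at hloss
  have hSw : (p * (n / (β * k) / 4)) * ∑ i ∈ S, θ i ≤ ∑ i ∈ S, w i := by
    rw [Finset.mul_sum]
    refine Finset.sum_le_sum fun i _ => ?_
    rw [mul_comm]
    exact mul_le_mul_of_nonneg_left
      (rowMass_bounds h hθ hδ hβ hp hα0.le hsmall (z i)).1 (hθ i)
  have hkpow : (k : ℝ) ^ (5 / 2 : ℝ) = k ^ 2 * √k := by
    rw [show (5 / 2 : ℝ) = 2 + 1 / 2 by norm_num, Real.rpow_add hk, Real.sqrt_eq_rpow]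
    norm_num
  have hsqrt : √(2 * k : ℝ) ≤ 2 * √k := by
    rw [Real.sqrt_le_left (by positivity), mul_pow, Real.sq_sqrt hk.le]
    linarith
  have hSθ : ∑ i ∈ S, θ i ≤ 2304 * α * β ^ 3 *
      ((1 + ε) * (k : ℝ) ^ (5 / 2 : ℝ) * K / (p - q)) := by
    refine le_of_mul_le_mul_left ((hSw.trans hS3).trans ?_)
      (by positivity : 0 < p * (n / (β * k) / 4))
    calc 12 * (1 + ε) * E / ((p - q) / (12 * α * β ^ 2 * p * k))
        ≤ 12 * (1 + ε) * (n * (2 * (K * (2 * √k)))) /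
            ((p - q) / (12 * α * β ^ 2 * p * k)) := by
          rw [hE]
          gcongr
      _ = _ := by
          rw [hkpow]
          field_simp
          norm_num
  calc misclassLoss θ z zhat ≤ (1 + 12 * β ^ 2) * ∑ i ∈ S, θ i := hloss
    _ ≤ (1 + 12 * β ^ 2) * (2304 * α * β ^ 3 *
      ((1 + ε) * (k : ℝ) ^ (5 / 2 : ℝ) * K / (p - q))) := by gcongr
    _ = _ := by ring

end Model

/-! ### The clustering guarantee -/

lemma exists_four_pow_near {x : ℝ} (hx : 1 ≤ x) : ∃ L : ℕ, x ≤ 4 ^ L ∧ (4 : ℝ) ^ L ≤ 4 * x := by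
  obtain ⟨m, h1, h2⟩ := exists_nat_pow_near hx (by norm_num : (1 : ℝ) < 4)
  exact ⟨m + 1, h2.le, by rw [pow_succ]; linarith⟩

/-- Outside an event of probability at most `1 / n²`, the spectral bound holds, with
`s = √(n p ‖θ‖² + 1)` and threshold `C₁ s²`. The power `4^L` is chosen within a factor `4` of
`α n p ‖θ‖² + 1`, which bounds the expected degrees. -/
theorem MemSpace'.measure_opBound {n k : ℕ} {θ : Fin n → ℝ} {p q α β δ : ℝ} {z : Fin n → Fin k}
    {B : Matrix (Fin k) (Fin k) ℝ} (h : MemSpace' θ p q β δ α z B) (hθ : ∀ i, 0 ≤ θ i)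
    (hδ : δ ≤ 1 / 2) (hβ : 1 ≤ β) (hq : 0 < q) (hα : 1 ≤ α) (hn : 17 ≤ n)
    (hsmall : ‖θ‖ ≤ n / (β * k) / 16) {Ω : Type*} [MeasurableSpace Ω] {μ : Measure Ω}
    [IsProbabilityMeasure μ] {A : Ω → Matrix (Fin n) (Fin n) ℝ}
    (hA : IsRandomGraph μ (probMatrix θ z B) A) {C₁ : ℝ} (hC₁ : 16 * α ≤ C₁) :
    1 - 1 / (n : ℝ) ^ 2 ≤ μ.real {ω | OpBound (trim (C₁ * (n * p * ‖θ‖ ^ 2 + 1)) (A ω) -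
      fullMatrix θ z B) ((5401 + 16 * C₁) * α * √(n * ‖θ‖ ^ 2 * p + 1))} := by
  have hp : 0 < p := hq.trans h.lt
  have hn' : (17 : ℝ) ≤ n := by exact_mod_cast hn
  have hn0 : (0 : ℝ) < n := by linarith
  set P := probMatrix θ z B with hPdef
  set D : ℝ := n * p * ‖θ‖ ^ 2 with hD
  have hD0 : 0 ≤ D := by positivity
  have hDs : n * ‖θ‖ ^ 2 * p + 1 = D + 1 := by rw [hD]; ring
  rw [hDs]
  set s := √(D + 1) with hs
  have hss : s ^ 2 = D + 1 := Real.sq_sqrt (by linarith)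
  have hs0 : 0 ≤ s := Real.sqrt_nonneg _
  obtain ⟨L, hL1, hL2⟩ := exists_four_pow_near (x := α * D + 1) (by nlinarith)
  have hB := h.B_nonneg hδ hp.le
  have hP : ∀ i j, 0 ≤ P i j := fun i j => (h.prob_mem i j).1
  have hPs : ∀ i j, P i j = P j i := by
    intro i j
    simp only [hPdef, probMatrix, Matrix.of_apply, eq_comm (a := i) (b := j),
      h.symm.apply (z i) (z j), mul_comm (θ i)]
  have hPd : ∀ i, P i i = 0 := fun i => by simp [hPdef, probMatrix]
  have hPL : ∀ i j, P i j ≤ 4 ^ L / n := by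
    intro i j
    have h1 : P i j ≤ ‖θ‖ * ‖θ‖ * (α * p) := by
      simp only [hPdef, probMatrix, Matrix.of_apply]
      split_ifs
      · positivity
      · have := hθ i
        have := hθ j
        gcongr
        · exact hB _ _
        · exact le_norm_degree θ i
        · exact le_norm_degree θ j
        · exact h.B_le _ _
    rw [le_div_iff₀ hn0]
    calc P i j * n ≤ ‖θ‖ * ‖θ‖ * (α * p) * n := by gcongr
      _ = α * D := by rw [hD]; ring
      _ ≤ 4 ^ L := by linarith
  have h2L : (2 : ℝ) ^ L ≤ 2 * α * s := by
    apply le_of_sq_le_sq _ (by positivity)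
    calc ((2 : ℝ) ^ L) ^ 2 = 4 ^ L := by rw [← pow_mul, mul_comm, pow_mul]; norm_num
      _ ≤ 4 * (α * D + 1) := hL2
      _ ≤ 4 * (α ^ 2 * (D + 1)) := by nlinarith [mul_nonneg (sub_nonneg.2 hα) hD0]
      _ = (2 * α * s) ^ 2 := by rw [mul_pow, hss]; ring
  have hdiag : OpBound (P - fullMatrix θ z B) (α * s) := by
    rw [hPdef, probMatrix_sub_fullMatrix]
    refine opBound_diagonal fun i => ?_
    have hθi := hθ i
    have hBi := hB (z i) (z i)
    -- from `p θ_i ≤ 4` and `θ_i ≤ n / 4`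
    have h1 : p * θ i ^ 2 ≤ s := by
      apply le_of_sq_le_sq _ hs0
      have h2 : θ i ≤ n / 4 := by
        have h3 : (n : ℝ) / (β * k) ≤ n := by
          refine div_le_self hn0.le (one_le_mul_of_one_le_of_one_le hβ ?_)
          exact_mod_cast (Nat.zero_lt_of_lt (z i).isLt)
        linarith [le_norm_degree θ i]
      have h4 := h.mul_degree_le hθ hδ hβ hsmall i
      rw [hss]
      calc (p * θ i ^ 2) ^ 2 = p * θ i ^ 2 * ((p * θ i) * θ i) := by ring
        _ ≤ p * θ i ^ 2 * (4 * (n / 4)) := by gcongr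
        _ ≤ p * ‖θ‖ ^ 2 * (4 * (n / 4)) := by
            gcongr
            exact le_norm_degree θ i
        _ ≤ D + 1 := by rw [hD]; linarith
    rw [abs_neg, abs_of_nonneg (by positivity)]
    calc θ i * θ i * B (z i) (z i) ≤ θ i * θ i * (α * p) := by
          gcongr
          exact h.B_le _ _
      _ = α * (p * θ i ^ 2) := by ring
      _ ≤ α * s := by gcongr
  have hgood : {ω | LightBound L P (A ω) ∧ DiscrepancyBound L (A ω)} ⊆
      {ω | OpBound (trim (C₁ * (D + 1)) (A ω) - fullMatrix θ z B)
        ((5401 + 16 * C₁) * α * s)} := by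
    rintro ω ⟨hl, hd⟩
    have hA0 : ∀ i j, 0 ≤ A ω i j := fun i j => by
      rcases hA.zero_or_one ω i j with h0 | h0 <;> simp [h0]
    have hC₁0 : 0 ≤ C₁ := by linarith
    have h1 := opBound_trim_sub (by omega) hl hd hA0 (hA.symm ω) hP hPL
      (τ := C₁ * (D + 1)) (c := C₁) (by nlinarith) (by
        refine mul_le_mul_of_nonneg_left ?_ hC₁0
        nlinarith)
    have h2 := h1.add hdiag
    rw [sub_add_sub_cancel] at h2
    refine h2.mono ?_
    have : (2700 + 8 * C₁) * 2 ^ L ≤ (2700 + 8 * C₁) * (2 * α * s) := by gcongr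
    linarith
  have hcompl : (Set.univ : Set Ω) ⊆ {ω | LightBound L P (A ω) ∧ DiscrepancyBound L (A ω)} ∪
      ({ω | ¬ LightBound L P (A ω)} ∪ {ω | ¬ DiscrepancyBound L (A ω)}) := by
    intro ω _
    simp only [Set.mem_union, Set.mem_ofPred_eq]
    tauto
  have hprob : 1 ≤ μ.real {ω | LightBound L P (A ω) ∧ DiscrepancyBound L (A ω)} +
      (Real.exp (-(3 * n : ℝ)) + 16 / (n : ℝ) ^ 3) := by
    calc (1 : ℝ) = μ.real Set.univ := by simp
      _ ≤ _ := measureReal_mono hcompl (measure_ne_top _ _)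
      _ ≤ _ := measureReal_union_le _ _
      _ ≤ _ := by
          gcongr
          refine (measureReal_union_le _ _).trans (add_le_add ?_ ?_)
          · exact hA.measure_not_lightBound_le hP hPs hPd L hPL
          · exact hA.measure_not_discrepancyBound_le hP hPs hPd L hPL
  have hfail : Real.exp (-(3 * n : ℝ)) + 16 / (n : ℝ) ^ 3 ≤ 1 / (n : ℝ) ^ 2 := by
    have h1 : Real.exp (-(3 * n : ℝ)) ≤ 1 / (n : ℝ) ^ 3 := by
      rw [Real.exp_neg, ← one_div]
      have h2 : (n : ℝ) ^ 3 ≤ Real.exp (3 * n) := by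
        calc (n : ℝ) ^ 3 ≤ Real.exp n ^ 3 := by
              gcongr
              linarith [Real.add_one_le_exp (n : ℝ)]
          _ = Real.exp (3 * n) := by rw [← Real.exp_nat_mul]; norm_num
      gcongr
    have h3 : 17 / (n : ℝ) ^ 3 ≤ 1 / (n : ℝ) ^ 2 := by
      rw [div_le_div_iff₀ (by positivity) (by positivity), one_mul, pow_succ (n : ℝ) 2,
        mul_comm]
      gcongr
    calc _ ≤ 1 / (n : ℝ) ^ 3 + 16 / (n : ℝ) ^ 3 := by gcongr
      _ = 17 / (n : ℝ) ^ 3 := by ring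
      _ ≤ _ := h3
  linarith [measureReal_mono hgood (measure_ne_top μ _)]

end DCBM

theorem mainTheorem7 (α β : ℝ) (hα : 1 ≤ α) (hβ : 1 ≤ β) :
    ∃ C₀ : ℝ, 0 < C₀ ∧ ∀ C₁ : ℝ, C₀ ≤ C₁ →
    ∃ C' C : ℝ, 0 < C' ∧ 0 < C ∧
    ∀ (k : ℕ → ℕ) (θ : (n : ℕ) → Fin n → ℝ) (p q δ : ℕ → ℝ),
      (∀ n i, 0 ≤ θ n i) →
      (∀ n, 0 < q n ∧ q n < p n) →
      Tendsto δ atTop (𝓝 0) →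
      (fun n => p n / q n) =O[atTop] (fun _ => (1 : ℝ)) →
      (fun n => ‖θ n‖) =o[atTop] (fun n => (n : ℝ) / (k n : ℝ)) →
      ∀ᶠ n : ℕ in atTop,
        ∀ (z : Fin n → Fin (k n)) (B : Matrix (Fin (k n)) (Fin (k n)) ℝ),
          DCBM.MemSpace' (θ n) (p n) (q n) β (δ n) α z B →
        ∀ (Ω : Type*) [MeasurableSpace Ω] (μ : Measure Ω) [IsProbabilityMeasure μ]
          (A : Ω → Matrix (Fin n) (Fin n) ℝ),
          DCBM.IsRandomGraph μ (DCBM.probMatrix (θ n) z B) A →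
        ∀ ε : ℝ, 0 ≤ ε →
          1 - (n : ℝ) ^ (-(1 + C')) ≤
            μ.real {ω | ∀ zhat : Fin n → Option (Fin (k n)),
              DCBM.IsClusteringOutput (C₁ * (n * p n * ‖θ n‖ ^ 2 + 1)) ε (A ω) zhat →
              DCBM.misclassLoss (θ n) z zhat ≤
                C * ((1 + ε) * (k n : ℝ) ^ (5 / 2 : ℝ) * √(n * ‖θ n‖ ^ 2 * p n + 1)
                  / (p n - q n))} := by
  refine ⟨16 * α, by linarith, fun C₁ hC₁ => ?_⟩
  have hC₁0 : 0 < C₁ := by linarith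
  have hα0 : 0 < α := by linarith
  have hβ0 : 0 < β := by linarith
  refine ⟨1, (1 + 12 * β ^ 2) * (2304 * α * β ^ 3) * ((5401 + 16 * C₁) * α), one_pos,
    by positivity, ?_⟩
  intro k θ p q δ hθ hpq hδ _ hθk
  have hδ' : ∀ᶠ n in atTop, δ n < 1 / 2 := hδ.eventually_lt_const (by norm_num)
  have hθ' := hθk.def (by positivity : 0 < 1 / (16 * β))
  filter_upwards [hδ', hθ', eventually_ge_atTop 17] with n hδn hθn hn z B hmem Ω _ μ _ A hA ε hε
  have hp : 0 < p n := (hpq n).1.trans (hpq n).2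
  have hsmall : ‖θ n‖ ≤ n / (β * k n) / 16 := by
    rw [norm_norm, Real.norm_of_nonneg (by positivity)] at hθn
    refine hθn.trans (le_of_eq ?_)
    rw [div_mul_div_comm, one_mul, div_div]
    congr 1
    ring
  have hpow : (n : ℝ) ^ (-(1 + 1) : ℝ) = 1 / (n : ℝ) ^ 2 := by
    rw [Real.rpow_neg (Nat.cast_nonneg n), one_div, show (1 + 1 : ℝ) = (2 : ℕ) by norm_num,
      Real.rpow_natCast]
  rw [hpow]
  refine (hmem.measure_opBound (hθ n) hδn.le hβ (hpq n).1 hα hn hsmall hA hC₁).trans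
    (measureReal_mono (fun ω hω zhat hz => ?_) (measure_ne_top _ _))
  have hs : 0 < √(n * ‖θ n‖ ^ 2 * p n + 1) := Real.sqrt_pos.2 (by positivity)
  refine (hmem.misclassLoss_le_of_opBound (hθ n) hδn.le hβ (hpq n).1 hα (by omega) hsmall
    (by positivity) hε hω hz).trans (le_of_eq ?_)
  ring
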